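/- All graphs are finite and simple. A network is a finite connected directed acyclic graph $N$ in which every vertex of indegree $0$ has outdegree at least $2$, every vertex of outdegree $0$ has indegree $1$, and no vertex has both indegree $1$ and outdegree $1$. It is arboreal if its underlying undirected graph is a tree. The leaves of $N$ are its vertices of outdegree $0$; $u$ is an ancestor of $v$ if there is a directed path (possibly of length $0$) from $u$ to $v$; a least common ancestor of two leaves is a common ancestor none of whose children is a common ancestor. In an arboreal network, two distinct leaves $x,y$ with a common ancestor have exactly one least common ancestor $\mathrm{lca}_N(x,y)$, and it has outdegree at least $2$. A labelled arboreal network $(N,t)$ is an arboreal network $N$ with a map $t$ from its vertices of outdegree at least $2$ to $\{0,1\}$. A graph $G$ is arboreal-explainable if there is a labelled arboreal network $(N,t)$ whose set of leaves is $V(G)$ such that any two distinct $x,y\in V(G)$ are adjacent in $G$ if and only if $x$ and $y$ have a common ancestor in $N$ and $t(\mathrm{lca}_N(x,y))=1$. A graph is hole-free if it has no induced cycle of size $5$ or more. The house is the $4$-cycle $abcd$ together with a vertex adjacent exactly to $a$ and $b$; the gem is the path on $4$ vertices together with a vertex adjacent to all of them; the domino is the $6$-cycle $v_0v_1v_2v_3v_4v_5$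 together with the chord $v_0v_3$. Corollary. Let $G$ be a graph with at least two vertices. Then $G$ is arboreal-explainable if and only if $G$ is hole-free and contains none of the house, the gem and the domino as an induced subgraph. In particular, arboreal-explainability is hereditary: if $G$ is arboreal-explainable, then so is every induced subgraph of $G$ with at least two vertices. -/

import Mathlib

/-- The indegree of a vertex: its number of parents. -/
noncomputable def Digraph.inDeg {W : Type*} (N : Digraph W) (v : W) : ℕ :=
  {u | N.Adj u v}.ncard

/-- The outdegree of a vertex: its number of children. -/
noncomputable def Digraph.outDeg {W : Type*} (N : Digraph W) (v : W) : ℕ :=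
  {u | N.Adj v u}.ncard

/-- `u` is an ancestor of `v`: there is a directed path (possibly of length `0`) from `u` to `v`. -/
def Digraph.IsAncestor {W : Type*} (N : Digraph W) (u v : W) : Prop :=
  Relation.ReflTransGen N.Adj u v

/-- A digraph is acyclic if no vertex lies on a directed closed path of positive length
(in particular it has no loops). -/
def Digraph.IsAcyclic {W : Type*} (N : Digraph W) : Prop :=
  ∀ v, ¬ Relation.TransGen N.Adj v v

/-- A network: a connected directed acyclic graph in which every vertex of indegree `0` has
outdegree at least `2`, every vertex of outdegree `0` has indegree `1`, and no vertex has both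
indegree `1` and outdegree `1`. -/
structure Digraph.IsNetwork {W : Type*} (N : Digraph W) : Prop where
  connected : N.toSimpleGraphInclusive.Connected
  acyclic : N.IsAcyclic
  root : ∀ v, N.inDeg v = 0 → 2 ≤ N.outDeg v
  leaf : ∀ v, N.outDeg v = 0 → N.inDeg v = 1
  not_suppressible : ∀ v, ¬ (N.inDeg v = 1 ∧ N.outDeg v = 1)

/-- An arboreal network: a network whose underlying undirected graph is a tree. -/
structure Digraph.IsArborealNetwork {W : Type*} (N : Digraph W) : Prop where
  isNetwork : N.IsNetwork
  isTree : N.toSimpleGraphInclusive.IsTree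

/-- The set of leaves (vertices of outdegree `0`). -/
def Digraph.leaves {W : Type*} (N : Digraph W) : Set W := {v | N.outDeg v = 0}

/-- The set of vertices of outdegree at least `2`. -/
def Digraph.branching {W : Type*} (N : Digraph W) : Set W := {v | 2 ≤ N.outDeg v}

/-- `x` and `y` share an ancestor. -/
def Digraph.ShareAncestor {W : Type*} (N : Digraph W) (x y : W) : Prop :=
  ∃ u, N.IsAncestor u x ∧ N.IsAncestor u y

/-- `u` is a least common ancestor of `x` and `y`: it is an ancestor of both, and no child of `u`
is an ancestor of both. -/
def Digraph.IsLCA {W : Type*} (N : Digraph W) (u x y : W) : Prop :=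
  (N.IsAncestor u x ∧ N.IsAncestor u y) ∧
    ∀ c, N.Adj u c → ¬ (N.IsAncestor c x ∧ N.IsAncestor c y)

theorem Digraph.IsLCA.symm {W : Type*} {N : Digraph W} {u x y : W} (h : N.IsLCA u x y) :
    N.IsLCA u y x :=
  ⟨h.1.symm, fun c hc hcc => h.2 c hc hcc.symm⟩

/-- The graph induced by a labelled network `(N, t)`, where `t` labels the vertices of
outdegree at least `2` by `0` or `1`. Its vertices are the leaves of `N`; distinct leaves `x`, `y`
are adjacent iff they share an ancestor and their least common ancestor has label `1`.
(It is used for arboreal networks only, where distinct leaves that share an ancestor have exactly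
one least common ancestor, and that vertex has outdegree at least `2`.) -/
def Digraph.explainedGraph {W : Type*} (N : Digraph W) (t : N.branching → Fin 2) :
    SimpleGraph N.leaves where
  Adj x y := x ≠ y ∧ N.ShareAncestor x y ∧ ∃ u : N.branching, N.IsLCA u x y ∧ t u = 1
  symm := ⟨by
    rintro x y ⟨hne, ⟨a, hax, hay⟩, u, hu, ht⟩
    exact ⟨hne.symm, ⟨a, hay, hax⟩, u, hu.symm, ht⟩⟩
  loopless := ⟨fun _ h => h.1 rfl⟩

/-- `G` is arboreal-explainable if, up to renaming of the vertices, it is the graph induced by some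
labelled arboreal network. (Networks are finite, so letting their vertex types range over `Type`
is no restriction.) -/
def SimpleGraph.ArborealExplainable {V : Type*} (G : SimpleGraph V) : Prop :=
  ∃ (W : Type) (_ : Finite W) (N : Digraph W) (t : N.branching → Fin 2),
    N.IsArborealNetwork ∧ Nonempty (G ≃g N.explainedGraph t)

/-- `G` is hole-free: it has no induced cycle of size at least `5`. -/
def SimpleGraph.HoleFree {V : Type*} (G : SimpleGraph V) : Prop :=
  ∀ n : ℕ, 5 ≤ n → ¬ (SimpleGraph.cycleGraph n).IsIndContained G

/-- The house: the `4`-cycle `0 1 2 3` with a vertex `4` adjacent to `0` and `1`. -/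
def houseGraph : SimpleGraph (Fin 5) :=
  SimpleGraph.fromEdgeSet {s(0, 1), s(1, 2), s(2, 3), s(3, 0), s(4, 0), s(4, 1)}

/-- The gem: the path `0 1 2 3` with a vertex `4` adjacent to all of its vertices. -/
def gemGraph : SimpleGraph (Fin 5) :=
  SimpleGraph.fromEdgeSet {s(0, 1), s(1, 2), s(2, 3), s(4, 0), s(4, 1), s(4, 2), s(4, 3)}

/-- The domino: the `6`-cycle `0 1 2 3 4 5` with the long chord `0 3`. -/
def dominoGraph : SimpleGraph (Fin 6) :=
  SimpleGraph.fromEdgeSet {s(0, 1), s(1, 2), s(2, 3), s(3, 4), s(4, 5), s(5, 0), s(0, 3)}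

/-! Both sides of the equivalence come down to one pruning property: every induced subgraph on at
least two vertices has a vertex of degree at most one or a pair of twins, that is, two vertices that
no third one distinguishes.

From networks to forbidden subgraphs: in a tree, some vertex `u` cuts at least two of the given
leaves off from each other and from the rest, which all lie beyond one edge. Adjacency across `u`
depends only on the position of each leaf relative to `u`, so few types occur and a short case
analysis gives a pendant vertex or twins (`Digraph.IsAcyclic.exists_pendant_or_twins`). House, gem,
domino and long cycles have neither.

From forbidden subgraphs to networks: fix a vertex `c`, split its non-neighbours into components,
and compare the attachments of these components in the neighbourhood of `c`, which induces no
four-vertex path because gems are excluded. This yields the pruning property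
(`SimpleGraph.HHDGFree.exists_pendant_or_twins`). Deleting a vertex so found and reinserting its
leaf by a local change of the network (`Digraph.Explains.insert_twin`,
`Digraph.Explains.insert_pendant`) builds the network by induction. -/

namespace Digraph

/-! ### Least common ancestors across a separating vertex -/

variable {W : Type*} {N : Digraph W}

/-- Two vertices have a least common ancestor satisfying `t`. -/
def MarkedLCA (N : Digraph W) (t : W → Prop) (a b : W) : Prop :=
  ∃ w, N.IsLCA w a b ∧ t w

theorem MarkedLCA.symm {t : W → Prop} {a b : W} (h : N.MarkedLCA t a b) : N.MarkedLCA t b a :=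
  let ⟨w, hw, ht⟩ := h
  ⟨w, hw.symm, ht⟩

/-- Every undirected walk from `a` to `b` passes through `u`. -/
def Separates (N : Digraph W) (u a b : W) : Prop :=
  ∀ p : N.toSimpleGraphInclusive.Walk a b, u ∈ p.support

theorem Separates.symm {u a b : W} (h : N.Separates u a b) : N.Separates u b a := fun p => by
  simpa using h p.reverse

theorem IsAcyclic.not_adj_of_isAncestor (hN : N.IsAcyclic) {u v : W} (h : N.IsAncestor u v) :
    ¬ N.Adj v u := fun hvu => hN u (Relation.TransGen.tail' h hvu)

theorem IsAcyclic.ne_of_adj (hN : N.IsAcyclic) {u v : W} (h : N.Adj u v) : u ≠ v := by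
  rintro rfl
  exact hN u (.single h)

theorem IsAncestor.exists_walk (hN : N.IsAcyclic) {u v : W} (h : N.IsAncestor u v) :
    ∃ p : N.toSimpleGraphInclusive.Walk u v,
      ∀ z ∈ p.support, N.IsAncestor u z ∧ N.IsAncestor z v := by
  induction h using Relation.ReflTransGen.head_induction_on with
  | refl => exact ⟨.nil, by simp [IsAncestor, Relation.ReflTransGen.refl]⟩
  | head hab hbv ih =>
    obtain ⟨p, hp⟩ := ih
    have hadj : N.toSimpleGraphInclusive.Adj _ _ :=
      (SimpleGraph.fromRel_adj N.Adj _ _).2 ⟨hN.ne_of_adj hab, Or.inl hab⟩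
    refine ⟨.cons hadj p, fun z hz => ?_⟩
    rw [SimpleGraph.Walk.support_cons, List.mem_cons] at hz
    rcases hz with rfl | hz
    · exact ⟨.refl, .head hab hbv⟩
    · exact ⟨.head hab (hp z hz).1, (hp z hz).2⟩

/-- The directed paths from `w` to `a` and to `b` join into a walk from `a` to `b`. It meets `u`, so
`u` lies on one of the two paths. -/
theorem Separates.isAncestor_of_common (hN : N.IsAcyclic) {u a b w : W} (h : N.Separates u a b)
    (ha : N.IsAncestor w a) (hb : N.IsAncestor w b) :
    N.IsAncestor w u ∧ (N.IsAncestor u a ∨ N.IsAncestor u b) := by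
  obtain ⟨p, hp⟩ := ha.exists_walk hN
  obtain ⟨q, hq⟩ := hb.exists_walk hN
  have := h (p.reverse.append q)
  rw [SimpleGraph.Walk.mem_support_append_iff, SimpleGraph.Walk.support_reverse,
    List.mem_reverse] at this
  rcases this with h | h
  · exact ⟨(hp u h).1, .inl (hp u h).2⟩
  · exact ⟨(hq u h).1, .inr (hq u h).2⟩

theorem Separates.markedLCA_iff_of_both (hN : N.IsAcyclic) {t : W → Prop} {u a b : W}
    (h : N.Separates u a b) (ha : N.IsAncestor u a) (hb : N.IsAncestor u b) :
    N.MarkedLCA t a b ↔ t u := by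
  constructor
  · rintro ⟨w, ⟨⟨hwa, hwb⟩, hw⟩, ht⟩
    rcases (h.isAncestor_of_common hN hwa hwb).1.cases_head with rfl | ⟨c, hwc, hcu⟩
    · exact ht
    · exact absurd ⟨hcu.trans ha, hcu.trans hb⟩ (hw c hwc)
  · intro ht
    refine ⟨u, ⟨⟨ha, hb⟩, fun c huc hc => ?_⟩, ht⟩
    exact hN.not_adj_of_isAncestor (h.isAncestor_of_common hN hc.1 hc.2).1 huc

/-- The common ancestors of `a` and `b` are exactly those of `a` and `u`, so `b` may be replaced by
`u`. -/
theorem Separates.markedLCA_iff_of_right (hN : N.IsAcyclic) {t : W → Prop} {u a b : W}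
    (h : N.Separates u a b) (hb : N.IsAncestor u b) :
    N.MarkedLCA t a b ↔ N.MarkedLCA t a u := by
  have key : ∀ w, N.IsAncestor w a ∧ N.IsAncestor w b ↔ N.IsAncestor w a ∧ N.IsAncestor w u :=
    fun w => ⟨fun hw => ⟨hw.1, (h.isAncestor_of_common hN hw.1 hw.2).1⟩,
      fun hw => ⟨hw.1, hw.2.trans hb⟩⟩
  simp only [MarkedLCA, IsLCA, key]

theorem Separates.not_markedLCA (hN : N.IsAcyclic) {t : W → Prop} {u a b : W}
    (h : N.Separates u a b) (ha : ¬ N.IsAncestor u a) (hb : ¬ N.IsAncestor u b) :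
    ¬ N.MarkedLCA t a b := by
  rintro ⟨w, ⟨⟨hwa, hwb⟩, -⟩, -⟩
  have := (h.isAncestor_of_common hN hwa hwb).2
  tauto

/-- Adjacency across a separating vertex `u` depends only on whether the two sides lie below `u`,
or else have a marked least common ancestor with `u`. -/
theorem Separates.markedLCA_iff (hN : N.IsAcyclic) {t : W → Prop} {u a b : W}
    (h : N.Separates u a b) :
    N.MarkedLCA t a b ↔ (N.IsAncestor u a ∧ N.IsAncestor u b ∧ t u) ∨
      (N.IsAncestor u a ∧ ¬ N.IsAncestor u b ∧ N.MarkedLCA t b u) ∨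
      (N.IsAncestor u b ∧ ¬ N.IsAncestor u a ∧ N.MarkedLCA t a u) := by
  by_cases ha : N.IsAncestor u a <;> by_cases hb : N.IsAncestor u b
  · simp [ha, hb, h.markedLCA_iff_of_both hN ha hb]
  · have : N.MarkedLCA t a b ↔ N.MarkedLCA t b a := ⟨.symm, .symm⟩
    simp [ha, hb, this, h.symm.markedLCA_iff_of_right hN ha]
  · simp [ha, hb, h.markedLCA_iff_of_right hN hb]
  · simp [ha, hb, h.not_markedLCA hN ha hb]

end Digraph

/-! ### A separating vertex in a tree with marked points -/

namespace SimpleGraph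

variable {W : Type*} {H : SimpleGraph W}

theorem IsTree.edges_subset_of_isPath (hH : H.IsTree) {a b : W} {p : H.Walk a b}
    (hp : p.IsPath) (q : H.Walk a b) : p.edges ⊆ q.edges := by
  classical
  have : q.bypass = p := (hH.existsUnique_path a b).unique q.bypass_isPath hp
  exact this ▸ q.edges_bypass_subset_edges

/-- In a tree with at least two marked points there is a vertex `u` and a set `S` of at least two
marked points that `u` separates from each other and from all remaining marked points, and the
remaining marked points all lie beyond a single edge `s u`. -/
theorem IsTree.exists_separating [Finite W] (hH : H.IsTree) {V : Type*} (f : V → W) {x₀ y₀ : V}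
    (hne : x₀ ≠ y₀) :
    ∃ (u : W) (S : Set V), (∃ x ∈ S, ∃ y ∈ S, x ≠ y) ∧
      (∀ x ∈ S, ∀ y, x ≠ y → ∀ p : H.Walk (f x) (f y), u ∈ p.support) ∧
      ((∀ x, x ∈ S) ∨ ∃ s, H.Adj s u ∧ ∀ z ∉ S, ∀ p : H.Walk u (f z), s(s, u) ∈ p.edges) := by
  classical
  have := Fintype.ofFinite W
  -- Root the tree at `r`. Then `T u` collects the marked points at or beyond `u`, and `u` is chosen
  -- as deep as possible with at least two of them.
  let r : W := f x₀
  let T : W → Set V := fun u => {x | ∀ p : H.Walk r (f x), u ∈ p.support}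
  let P : ℕ → Prop := fun n => ∃ (u : W) (q : H.Walk r u), q.IsPath ∧ q.length = n ∧
    ∃ x ∈ T u, ∃ y ∈ T u, x ≠ y
  have hP0 : P 0 := ⟨r, .nil, by simp, rfl, x₀, fun p => p.start_mem_support, y₀,
    fun p => p.start_mem_support, hne⟩
  have hbd : ∀ n, P n → n ≤ Fintype.card W := by
    rintro n ⟨u, q, hq, rfl, -⟩
    exact hq.length_lt.le
  obtain ⟨u, q, hq, hql, hxy⟩ := Nat.findGreatest_spec (P := P) (Nat.zero_le _) hP0
  have hmax : ∀ m, P m → m ≤ q.length := fun m hm => by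
    rw [hql]
    exact Nat.le_findGreatest (hbd m hm) hm
  have hcross : ∀ z, z ∉ T u → ∃ g : H.Walk r (f z), u ∉ g.support := fun z hz => by
    simpa [T] using hz
  refine ⟨u, T u, hxy, fun x hx y hxy p => ?_, ?_⟩
  · by_contra hup
    by_cases hy : y ∈ T u
    swap
    · obtain ⟨g, hg⟩ := hcross y hy
      have := hx (g.append p.reverse)
      simp_all
    -- The path to `f x` continues past `u` to some `c`. A walk from `f x` to `f y` avoiding `u`
    -- puts `y` beyond `c` too, so `c` contradicts the depth of `u`.
    obtain ⟨p₀, hp₀, -⟩ := hH.existsUnique_path r (f x)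
    obtain ⟨a, b, hab⟩ := SimpleGraph.Walk.mem_support_iff_exists_append.1 (hx p₀)
    cases b with
    | nil => exact hup p.start_mem_support
    | @cons _ c _ h b =>
      have hpath : ((a.concat h).append b).IsPath := by
        rw [SimpleGraph.Walk.concat_append, ← hab]; exact hp₀
      have ha : a = q := (hH.existsUnique_path r u).unique
        (by rw [hab] at hp₀; exact hp₀.of_append_left) hq
      have hedge : s(u, c) ∈ p₀.edges := by simp [hab]
      have : P (q.length + 1) := by
        refine ⟨c, a.concat h, hpath.of_append_left, by simp [ha], x, fun g => ?_, y, fun g => ?_,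
          hxy⟩
        · exact SimpleGraph.Walk.snd_mem_support_of_mem_edges _
            (hH.edges_subset_of_isPath hp₀ g hedge)
        · have := hH.edges_subset_of_isPath hp₀ (g.append p.reverse) hedge
          rw [SimpleGraph.Walk.edges_append, List.mem_append, SimpleGraph.Walk.edges_reverse,
            List.mem_reverse] at this
          rcases this with h | h
          · exact SimpleGraph.Walk.snd_mem_support_of_mem_edges _ h
          · exact absurd (SimpleGraph.Walk.fst_mem_support_of_mem_edges _ h) hup
      have := hmax _ this
      omega
  · by_cases hur : u = r
    · left
      intro x p
      rw [hur]
      exact p.start_mem_support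
    · right
      have hnil : ¬ q.Nil := fun h => hur h.eq.symm
      refine ⟨q.penultimate, q.adj_penultimate hnil, fun z hz k => ?_⟩
      obtain ⟨g, hg⟩ := hcross z hz
      have hedge : s(q.penultimate, u) ∈ q.edges := by
        simpa using q.mk_penultimate_end_mem_edges hnil
      have := hH.edges_subset_of_isPath hq (g.append k.reverse) hedge
      rw [SimpleGraph.Walk.edges_append, List.mem_append, SimpleGraph.Walk.edges_reverse,
        List.mem_reverse] at this
      rcases this with h | h
      · exact absurd (SimpleGraph.Walk.snd_mem_support_of_mem_edges _ h) hg
      · exact h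

end SimpleGraph

/-! ### Pruning in polytrees -/

/-- In any family of at least two points of a finite polytree there are two points that no third
point distinguishes by `MarkedLCA`, or a point related to at most one other point. -/
theorem Digraph.IsAcyclic.exists_pendant_or_twins {W : Type*} [Finite W] {N : Digraph W}
    (hN : N.IsAcyclic) (hT : N.toSimpleGraphInclusive.IsTree) (t : W → Prop) {V : Type*}
    (f : V → W) {x₀ y₀ : V} (hne : x₀ ≠ y₀) :
    (∃ x, ∃ w, ∀ y, y ≠ x → N.MarkedLCA t (f x) (f y) → y = w) ∨
      ∃ x y, x ≠ y ∧ ∀ z, z ≠ x → z ≠ y →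
        (N.MarkedLCA t (f x) (f z) ↔ N.MarkedLCA t (f y) (f z)) := by
  obtain ⟨u, S, ⟨x, hx, y, hy, hxy⟩, hS, hout⟩ := hT.exists_separating f hne
  -- Relative to `u` a point is below it (`O`), or has a marked least common ancestor with it
  -- without being below (`I`), or neither. For a point of `S` this type determines all adjacencies.
  set O : V → Prop := fun z => N.IsAncestor u (f z) with hO
  set I : V → Prop := fun z => ¬ N.IsAncestor u (f z) ∧ N.MarkedLCA t (f z) u with hI
  have hE : ∀ a ∈ S, ∀ b, b ≠ a → (N.MarkedLCA t (f a) (f b) ↔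
      (O a ∧ O b ∧ t u) ∨ (O a ∧ I b) ∨ (O b ∧ I a)) := fun a ha b hba =>
    Separates.markedLCA_iff hN (hS a ha b hba.symm)
  have hOI : ∀ z, I z → ¬ O z := fun z hz => hz.1
  -- The edge between `s` and `u` leads to all points outside `S`. Directed into `u`, it keeps them
  -- from being below `u`; directed out of `u`, it forces every one that shares an ancestor with `u`
  -- to be below `u`.
  have hdir : (∀ z ∉ S, ¬ O z) ∨ (∀ z ∉ S, ¬ I z) := by
    rcases hout with hall | ⟨s, hsu, hs⟩
    · exact .inl fun z hz => absurd (hall z) hz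
    rcases ((SimpleGraph.fromRel_adj N.Adj _ _).1 hsu).2 with h | h
    · left
      intro z hz hOz
      obtain ⟨p, hp⟩ := IsAncestor.exists_walk hN hOz
      have := hp s (SimpleGraph.Walk.fst_mem_support_of_mem_edges _ (hs z hz p))
      exact hN.not_adj_of_isAncestor this.1 h
    · right
      rintro z hz ⟨hOz, w, ⟨⟨hwz, hwu⟩, -⟩, -⟩
      obtain ⟨p, hp⟩ := IsAncestor.exists_walk hN hwu
      obtain ⟨q, hq⟩ := IsAncestor.exists_walk hN hwz
      have := hs z hz (p.reverse.append q)
      rw [SimpleGraph.Walk.edges_append, List.mem_append, SimpleGraph.Walk.edges_reverse,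
        List.mem_reverse] at this
      rcases this with h' | h'
      · have := hp s (SimpleGraph.Walk.fst_mem_support_of_mem_edges _ h')
        exact hN.not_adj_of_isAncestor this.2 h
      · exact hOz (hq u (SimpleGraph.Walk.snd_mem_support_of_mem_edges _ h')).2
  have hsame : ∀ a ∈ S, ∀ b ∈ S, a ≠ b → (O a ↔ O b) → (I a ↔ I b) →
      ∃ x y, x ≠ y ∧ ∀ z, z ≠ x → z ≠ y →
        (N.MarkedLCA t (f x) (f z) ↔ N.MarkedLCA t (f y) (f z)) := by
    intro a ha b hb hab h1 h2
    refine ⟨a, b, hab, fun z hza hzb => ?_⟩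
    rw [hE a ha z hza, hE b hb z hzb, h1, h2]
  have hnone : ∀ a ∈ S, ¬ O a → ¬ I a →
      ∃ x, ∃ w, ∀ y, y ≠ x → N.MarkedLCA t (f x) (f y) → y = w := by
    intro a ha h1 h2
    refine ⟨a, a, fun z hz h => ?_⟩
    rw [hE a ha z hz] at h
    tauto
  clear_value O I
  have main : ∀ x ∈ S, ∀ y ∈ S, x ≠ y → I x → O y →
      (∃ x, ∃ w, ∀ y, y ≠ x → N.MarkedLCA t (f x) (f y) → y = w) ∨
      ∃ x y, x ≠ y ∧ ∀ z, z ≠ x → z ≠ y →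
        (N.MarkedLCA t (f x) (f z) ↔ N.MarkedLCA t (f y) (f z)) := by
    intro x hx y hy hxy hIx hOy
    have hOx := hOI x hIx
    have hIy : ¬ I y := fun h => hOI y h hOy
    by_cases hz : ∃ z ∈ S, z ≠ x ∧ z ≠ y
    · obtain ⟨z, hz, hzx, hzy⟩ := hz
      by_cases hOz : O z
      · exact .inr (hsame z hz y hy hzy (by tauto) (by have := hOI z; tauto))
      by_cases hIz : I z
      · exact .inr (hsame z hz x hx hzx (by tauto) (by tauto))
      · exact .inl (hnone z hz hOz hIz)
    · push Not at hz
      -- Now `S` is just `{x, y}`. Points of type `I` in `S` see exactly the `O` points; points of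
      -- type `O` see the `I` points, and the other `O` points precisely when `t u` holds.
      rcases hdir with hdir | hdir
      · left
        refine ⟨x, y, fun z hzx h => ?_⟩
        by_contra hzy
        have := hdir z (fun hzS => hzy (hz z hzS hzx))
        rw [hE x hx z hzx] at h
        tauto
      · by_cases ht : t u
        · right
          refine ⟨x, y, hxy, fun z hzx hzy => ?_⟩
          have := hdir z (fun hzS => hzy (hz z hzS hzx))
          rw [hE x hx z hzx, hE y hy z hzy]
          tauto
        · left
          refine ⟨y, x, fun z hzy h => ?_⟩
          by_contra hzx
          have := hdir z (fun hzS => hzy (hz z hzS hzx))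
          rw [hE y hy z hzy] at h
          tauto
  by_cases hOx : O x <;> by_cases hOy : O y
  · exact .inr (hsame x hx y hy hxy (by tauto) (by have := hOI x; have := hOI y; tauto))
  · by_cases hIy : I y
    · exact main y hy x hx hxy.symm hIy hOx
    · exact .inl (hnone y hy hOy hIy)
  · by_cases hIx : I x
    · exact main x hx y hy hxy hIx hOy
    · exact .inl (hnone x hx hOx hIx)
  · by_cases hIx : I x
    · by_cases hIy : I y
      · exact .inr (hsame x hx y hy hxy (by tauto) (by tauto))
      · exact .inl (hnone y hy hOy hIy)
    · exact .inl (hnone x hx hOx hIx)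

/-! ### The forbidden graphs have no pendant vertex and no twins -/

namespace SimpleGraph

/-- A graph in which every vertex has degree at least `2` and no two vertices are twins. -/
structure NoPendantOrTwins {V : Type*} (F : SimpleGraph V) : Prop where
  exists_adj_ne : ∀ x w, ∃ y, F.Adj x y ∧ y ≠ w
  exists_distinguishing : ∀ x y, x ≠ y → ∃ z, z ≠ x ∧ z ≠ y ∧ ¬ (F.Adj x z ↔ F.Adj y z)

theorem ArborealExplainable.not_isIndContained {V V' : Type*} {G : SimpleGraph V}
    (hG : G.ArborealExplainable) {F : SimpleGraph V'} [Nonempty V'] (hF : F.NoPendantOrTwins) :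
    ¬ F.IsIndContained G := by
  rintro ⟨e⟩
  obtain ⟨W, _, N, t, hN, ⟨i⟩⟩ := hG
  let f : V' → W := fun x => (i (e x)).1
  -- Vertices outside `N.branching` count as unmarked, so a marked least common ancestor always
  -- carries a label of `t`.
  let t' : W → Prop := fun u => ∃ h : u ∈ N.branching, t ⟨u, h⟩ = 1
  have hadj : ∀ x y, y ≠ x → (F.Adj x y ↔ N.MarkedLCA t' (f x) (f y)) := by
    intro x y hyx
    rw [← e.map_adj_iff, ← i.map_adj_iff]
    constructor
    · rintro ⟨-, -, u, hu, ht⟩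
      exact ⟨u, hu, u.2, ht⟩
    · rintro ⟨u, hu, h, ht⟩
      exact ⟨fun h => hyx (e.injective (i.injective h)).symm, ⟨u, hu.1⟩, ⟨u, h⟩, hu, ht⟩
  obtain ⟨x⟩ := ‹Nonempty V'›
  obtain ⟨y, hxy, -⟩ := hF.exists_adj_ne x x
  rcases hN.isNetwork.acyclic.exists_pendant_or_twins hN.isTree t' f hxy.ne with
    ⟨x, w, h⟩ | ⟨x, y, hxy, h⟩
  · obtain ⟨y, hy, hyw⟩ := hF.exists_adj_ne x w
    exact hyw (h y hy.ne' ((hadj x y hy.ne').1 hy))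
  · obtain ⟨z, hzx, hzy, hz⟩ := hF.exists_distinguishing x y hxy
    exact hz (by rw [hadj x z hzx, hadj y z hzy, h z hzx hzy])

theorem noPendantOrTwins_house : houseGraph.NoPendantOrTwins := by
  constructor <;> simp only [houseGraph, fromEdgeSet_adj] <;> decide

theorem noPendantOrTwins_gem : gemGraph.NoPendantOrTwins := by
  constructor <;> simp only [gemGraph, fromEdgeSet_adj] <;> decide

theorem noPendantOrTwins_domino : dominoGraph.NoPendantOrTwins := by
  constructor <;> simp only [dominoGraph, fromEdgeSet_adj] <;> decide

theorem cycleGraph_adj_iff_val {n : ℕ} {u v : Fin n} :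
    (cycleGraph n).Adj u v ↔ u ≠ v ∧ (u.val + 1 = v.val ∨ v.val + 1 = u.val ∨
      (u.val = 0 ∧ v.val + 1 = n) ∨ (v.val = 0 ∧ u.val + 1 = n)) := by
  rw [cycleGraph_adj', ne_eq, Fin.ext_iff]
  obtain ⟨u, hu⟩ := u
  obtain ⟨v, hv⟩ := v
  simp only [Fin.sub_def]
  rcases lt_trichotomy u v with h | rfl | h
  · rw [Nat.mod_eq_of_lt (a := n - v + u) (by omega), show n - u + v = n + (v - u) by omega,
      Nat.add_mod_left, Nat.mod_eq_of_lt (by omega)]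
    omega
  · simp [show n - u + u = n by omega]
  · rw [Nat.mod_eq_of_lt (a := n - u + v) (by omega), show n - v + u = n + (u - v) by omega,
      Nat.add_mod_left, Nat.mod_eq_of_lt (by omega)]
    omega

theorem noPendantOrTwins_cycleGraph {n : ℕ} (hn : 5 ≤ n) : (cycleGraph n).NoPendantOrTwins := by
  have hsucc : ∀ x : Fin n, ∃ y : Fin n, (x.val + 1 = y.val ∨ (y.val = 0 ∧ x.val + 1 = n)) :=
    fun x => by
      by_cases h : x.val + 1 = n
      · exact ⟨⟨0, by omega⟩, .inr ⟨rfl, h⟩⟩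
      · exact ⟨⟨x.val + 1, by omega⟩, .inl rfl⟩
  have hpred : ∀ x : Fin n, ∃ y : Fin n, (y.val + 1 = x.val ∨ (x.val = 0 ∧ y.val + 1 = n)) :=
    fun x => by
      by_cases h : x.val = 0
      · exact ⟨⟨n - 1, by omega⟩, .inr ⟨h, by simp; omega⟩⟩
      · exact ⟨⟨x.val - 1, by omega⟩, .inl (by simp; omega)⟩
  constructor
  · intro x w
    obtain ⟨y, hy⟩ := hsucc x
    obtain ⟨z, hz⟩ := hpred x
    by_cases h : y = w
    · refine ⟨z, ?_, ?_⟩ <;> simp only [cycleGraph_adj_iff_val, Fin.ext_iff, ne_eq] at * <;> omega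
    · exact ⟨y, by simp only [cycleGraph_adj_iff_val, Fin.ext_iff, ne_eq] at *; omega, h⟩
  · intro x y hxy
    obtain ⟨a, ha⟩ := hsucc x
    obtain ⟨b, hb⟩ := hpred x
    obtain ⟨c, hc⟩ := hsucc a
    obtain ⟨x, hx⟩ := x
    obtain ⟨y, hy⟩ := y
    obtain ⟨a, ha'⟩ := a
    obtain ⟨b, hb'⟩ := b
    obtain ⟨c, hc'⟩ := c
    clear hsucc hpred
    simp only [ne_eq, Fin.mk.injEq] at ha hb hc hxy
    have hab : ¬ b = x ∧ ¬ a = x := by omega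
    -- Going round the cycle the order is `b`, `x`, `a`, `c`. The neighbour `a` of `x` distinguishes
    -- `x` from `y` unless `y` is `a` or its neighbour `c`; then `b` does, since the cycle has at
    -- least five vertices.
    by_cases h : y = a ∨ y = c
    · have h1 : ¬ b = y := by omega
      refine ⟨⟨b, hb'⟩, by simpa using hab.1, by simpa using h1, fun h' => ?_⟩
      rw [cycleGraph_adj_iff_val, cycleGraph_adj_iff_val] at h'
      have h2 := (h'.1 ⟨fun e => hab.1 (Fin.mk.inj e).symm,
        .inr (hb.elim .inl fun h => .inr (.inl h))⟩).2
      simp only at h2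
      clear h'
      rcases h with rfl | rfl <;> omega
    · have h1 : ¬ a = y := by omega
      refine ⟨⟨a, ha'⟩, by simpa using hab.2, by simpa using h1, fun h' => ?_⟩
      rw [cycleGraph_adj_iff_val, cycleGraph_adj_iff_val] at h'
      have h2 := (h'.1 ⟨fun e => hab.2 (Fin.mk.inj e).symm,
        ha.elim .inl fun h => .inr (.inr (.inr h))⟩).2
      simp only at h2
      clear h'
      omega

theorem ArborealExplainable.forbidden {V : Type*} {G : SimpleGraph V}
    (hG : G.ArborealExplainable) :
    G.HoleFree ∧ ¬ houseGraph.IsIndContained G ∧ ¬ gemGraph.IsIndContained G ∧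
      ¬ dominoGraph.IsIndContained G := by
  refine ⟨fun n hn => ?_, hG.not_isIndContained noPendantOrTwins_house,
    hG.not_isIndContained noPendantOrTwins_gem, hG.not_isIndContained noPendantOrTwins_domino⟩
  have : Nonempty (Fin n) := ⟨⟨0, by omega⟩⟩
  exact hG.not_isIndContained (noPendantOrTwins_cycleGraph hn)

end SimpleGraph

/-! ### Forbidden subgraphs on vertices, and induced paths -/

namespace SimpleGraph

variable {V : Type*} {G : SimpleGraph V}

/-- The absence of induced houses, gems, dominos and holes, spelled out on vertices. A hole is given
as an induced path together with a vertex adjacent to exactly its two ends. -/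
structure HHDGFree (G : SimpleGraph V) : Prop where
  house : ∀ {a b c d e}, G.Adj a b → G.Adj b c → G.Adj c d → G.Adj d a → G.Adj e a → G.Adj e b →
    ¬ G.Adj a c → ¬ G.Adj b d → ¬ G.Adj e c → ¬ G.Adj e d → False
  gem : ∀ {a b c d e}, G.Adj a b → G.Adj b c → G.Adj c d → G.Adj e a → G.Adj e b → G.Adj e c →
    G.Adj e d → ¬ G.Adj a c → ¬ G.Adj a d → ¬ G.Adj b d → False
  domino : ∀ {a b c d e f}, G.Adj a b → G.Adj b c → G.Adj c d → G.Adj d e → G.Adj e f →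
    G.Adj f a → G.Adj a d → ¬ G.Adj a c → ¬ G.Adj a e → ¬ G.Adj b d → ¬ G.Adj b f → ¬ G.Adj c e →
    ¬ G.Adj c f → ¬ G.Adj d f → ¬ G.Adj b e → False
  hole : ∀ (p : ℕ → V) (k : ℕ) (c : V), 3 ≤ k →
    (∀ i ≤ k, ∀ j ≤ k, (G.Adj (p i) (p j) ↔ i + 1 = j ∨ j + 1 = i)) →
    (∀ i ≤ k, (G.Adj c (p i) ↔ i = 0 ∨ i = k)) → False

/-- Injectivity is automatic: two vertices of `F` with the same image would be twins. -/
theorem NoPendantOrTwins.isIndContained {V' : Type*} {F : SimpleGraph V'}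
    (hF : F.NoPendantOrTwins) (f : V' → V) (h : ∀ i j, G.Adj (f i) (f j) ↔ F.Adj i j) :
    F.IsIndContained G := by
  refine ⟨⟨⟨f, fun i j hij => ?_⟩, h _ _⟩⟩
  by_contra hne
  obtain ⟨z, -, -, hz⟩ := hF.exists_distinguishing i j hne
  exact hz (by rw [← h, ← h, hij])

theorem HoleFree.hhdgFree (h₁ : G.HoleFree) (h₂ : ¬ houseGraph.IsIndContained G)
    (h₃ : ¬ gemGraph.IsIndContained G) (h₄ : ¬ dominoGraph.IsIndContained G) : G.HHDGFree where
  house := by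
    intro a b c d e h1 h2 h3 h4 h5 h6 h7 h8 h9 h10
    refine h₂ (noPendantOrTwins_house.isIndContained ![a, b, c, d, e] fun i j => ?_)
    fin_cases i <;> fin_cases j <;>
      simp [houseGraph, h1, h2, h3, h4, h5, h6, h7, h8, h9, h10, h1.symm, h2.symm, h3.symm, h4.symm,
        h5.symm, h6.symm, mt Adj.symm h7, mt Adj.symm h8, mt Adj.symm h9, mt Adj.symm h10]
  gem := by
    intro a b c d e h1 h2 h3 h4 h5 h6 h7 h8 h9 h10
    refine h₃ (noPendantOrTwins_gem.isIndContained ![a, b, c, d, e] fun i j => ?_)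
    fin_cases i <;> fin_cases j <;>
      simp [gemGraph, h1, h2, h3, h4, h5, h6, h7, h8, h9, h10, h1.symm, h2.symm, h3.symm, h4.symm,
        h5.symm, h6.symm, h7.symm, mt Adj.symm h8, mt Adj.symm h9, mt Adj.symm h10]
  domino := by
    intro a b c d e f h1 h2 h3 h4 h5 h6 h7 g1 g2 g3 g4 g5 g6 g7 g8
    refine h₄ (noPendantOrTwins_domino.isIndContained ![a, b, c, d, e, f] fun i j => ?_)
    fin_cases i <;> fin_cases j <;>
      simp [dominoGraph, h1, h2, h3, h4, h5, h6, h7, h1.symm, h2.symm, h3.symm, h4.symm,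
        h5.symm, h6.symm, h7.symm, g1, g2, g3, g4, g5, g6, g7, g8, mt Adj.symm g1, mt Adj.symm g2,
        mt Adj.symm g3, mt Adj.symm g4, mt Adj.symm g5, mt Adj.symm g6, mt Adj.symm g7,
        mt Adj.symm g8]
  hole := by
    intro p k c hk hp hc
    refine h₁ (k + 2) (by omega) ((noPendantOrTwins_cycleGraph (by omega)).isIndContained
      (fun i => if i.val ≤ k then p i.val else c) fun ⟨i, hi⟩ ⟨j, hj⟩ => ?_)
    rw [cycleGraph_adj_iff_val, ne_eq, Fin.mk.injEq]
    simp only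
    split_ifs with h1 h2 h2
    · rw [hp i h1 j h2]
      omega
    · rw [G.adj_comm, hc i h1]
      omega
    · rw [hc j h2]
      omega
    · simp only [G.irrefl, false_iff]
      omega

/-- A shortest walk is induced, since a chord or a repeated vertex would shorten it. -/
theorem exists_induced_path {M : V → Prop} {r y : V}
    (h : Relation.ReflTransGen (fun a b => G.Adj a b ∧ M b) r y) :
    ∃ (n : ℕ) (p : ℕ → V), p 0 = r ∧ p n = y ∧ (∀ i, 0 < i → i ≤ n → M (p i)) ∧
      (∀ i j, i < j → j ≤ n → p i ≠ p j) ∧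
      ∀ i ≤ n, ∀ j ≤ n, (G.Adj (p i) (p j) ↔ i + 1 = j ∨ j + 1 = i) := by
  classical
  let C : ℕ → Prop := fun n => ∃ p : ℕ → V, p 0 = r ∧ p n = y ∧
    ∀ i < n, G.Adj (p i) (p (i + 1)) ∧ M (p (i + 1))
  have hC : ∃ n, C n := by
    induction h with
    | refl => exact ⟨0, fun _ => r, rfl, rfl, by simp⟩
    | @tail b c _ hbc ih =>
      obtain ⟨n, p, h0, hn, hp⟩ := ih
      refine ⟨n + 1, fun i => if i ≤ n then p i else c, by simpa using h0, by simp, fun i hi => ?_⟩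
      rcases Nat.lt_succ_iff_lt_or_eq.1 hi with hi | rfl
      · simpa [hi.le, Nat.succ_le_of_lt hi] using hp i hi
      · simpa [hn] using hbc
  obtain ⟨p, h0, hn, hp⟩ := Nat.find_spec hC
  set n := Nat.find hC
  -- Removes the `d` vertices after `p i`. The last hypothesis covers the case where the removed
  -- piece reaches the end of the walk.
  have short : ∀ i d, 0 < d → i + d ≤ n → (i + d < n → G.Adj (p i) (p (i + d + 1))) →
      (i + d = n → p i = y) → False := by
    intro i d hd hid h1 h2
    refine Nat.find_min hC (show n - d < n by omega)
      ⟨fun m => if m ≤ i then p m else p (m + d), by simpa using h0, ?_, fun m hm => ?_⟩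
    · beta_reduce
      rcases hid.lt_or_eq with h | h
      · rw [if_neg (by omega), Nat.sub_add_cancel (by omega), hn]
      · rw [if_pos (by omega), show n - d = i by omega, h2 h]
    · beta_reduce
      rcases lt_trichotomy m i with h | rfl | h
      · rw [if_pos h.le, if_pos (by omega)]
        exact hp m (by omega)
      · rw [if_pos le_rfl, if_neg (by omega), show m + 1 + d = m + d + 1 by omega]
        exact ⟨h1 (by omega), (hp (m + d) (by omega)).2⟩
      · rw [if_neg (by omega), if_neg (by omega), show m + 1 + d = m + d + 1 by omega]
        exact hp (m + d) (by omega)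
  have hadj : ∀ i j, i < j → j ≤ n → G.Adj (p i) (p j) → i + 1 = j := by
    intro i j hij hj h
    by_contra hne
    refine short i (j - i - 1) (by omega) (by omega) (fun _ => ?_) (by omega)
    rwa [show i + (j - i - 1) + 1 = j by omega]
  refine ⟨n, p, h0, hn, fun i hi hin => ?_, fun i j hij hj h => ?_, fun i hi j hj =>
    ⟨fun h => ?_, fun h => ?_⟩⟩
  · obtain ⟨i, rfl⟩ := Nat.exists_eq_add_of_lt hi
    simpa using (hp (0 + i) (by omega)).2
  · refine short i (j - i) (by omega) (by omega) (fun h' => ?_) (fun h' => ?_)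
    · rw [show i + (j - i) + 1 = j + 1 by omega, h]
      exact (hp j (by omega)).1
    · rw [h, show j = n by omega, hn]
  · rcases lt_trichotomy i j with hij | rfl | hij
    · exact .inl (hadj i j hij hj h)
    · exact absurd h (G.irrefl)
    · exact .inr (hadj j i hij hi h.symm)
  · rcases h with rfl | rfl
    · exact (hp i (by omega)).1
    · exact (hp j (by omega)).1.symm

namespace HHDGFree

/-- If `B` consists of non-neighbours of `c`, then all vertices of a connected component of `B`
having a neighbour in `N(c)` have the same neighbours in `N(c)`. -/
theorem adj_of_reachable (hG : G.HHDGFree) {c : V} {B : V → Prop} (hB : ∀ z, B z → ¬ G.Adj c z)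
    {x y r s : V} (hcx : G.Adj c x) (hcy : G.Adj c y) (hr : B r)
    (hrs : Relation.ReflTransGen (fun a b => G.Adj a b ∧ B b) r s) (hsy : G.Adj s y)
    (hrx : G.Adj r x) : G.Adj r y := by
  classical
  by_contra hry
  have hry' : Relation.ReflTransGen (fun a b => G.Adj a b ∧ (B b ∨ b = y)) r y :=
    (hrs.lift id fun a b h => ⟨h.1, .inl h.2⟩).tail ⟨hsy, .inr rfl⟩
  obtain ⟨n, p, h0, hn, hM, hinj, hp⟩ := exists_induced_path hry'
  have hxr : G.Adj x (p 0) := h0 ▸ hrx.symm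
  obtain ⟨k, rfl⟩ : ∃ k, n = k + 1 := by
    refine Nat.exists_eq_succ_of_ne_zero ?_
    rintro rfl
    exact hB r hr (h0 ▸ hn ▸ hcy)
  have hk : 1 ≤ k := by
    by_contra hk
    obtain rfl : k = 0 := by omega
    exact hry (by rw [← h0, ← hn]; exact (hp 0 (by omega) 1 (by omega)).2 (.inl rfl))
  have hBp : ∀ i ≤ k, B (p i) := by
    intro i hi
    rcases Nat.eq_zero_or_pos i with rfl | hi0
    · rwa [h0]
    · exact (hM i hi0 (by omega)).resolve_right fun h =>
        hinj i (k + 1) (by omega) le_rfl (h.trans hn.symm)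
  have hcp : ∀ i ≤ k, ¬ G.Adj c (p i) := fun i hi => hB _ (hBp i hi)
  have hky : G.Adj (p k) y := hn ▸ (hp k (by omega) (k + 1) le_rfl).2 (.inl rfl)
  have hpy : ∀ i < k, ¬ G.Adj (p i) y := fun i hi h => by
    rw [← hn, hp i (by omega) (k + 1) le_rfl] at h
    omega
  have hlast : ∀ m, ∃ i ≤ m, G.Adj x (p i) ∧ ∀ j, i < j → j ≤ m → ¬ G.Adj x (p j) := fun m =>
    ⟨_, Nat.findGreatest_le m, Nat.findGreatest_spec (P := fun i => G.Adj x (p i))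
      (Nat.zero_le m) hxr, fun j => Nat.findGreatest_is_greatest⟩
  -- The path runs from `r` through `B` to `y = p (k + 1)`, and `p i` is its last vertex before `y`
  -- adjacent to `x`. If `i < k`, the part from `p i` to `y` closes up through `x`, or through `x`
  -- and `c`, into a house or a hole.
  obtain ⟨i, hik, hxi, hi⟩ := hlast k
  rcases hik.lt_or_eq with hik | rfl
  · by_cases hxy : G.Adj x y
    · rcases (show i + 1 = k ∨ i + 1 < k by omega) with rfl | hik'
      · exact hG.house hxy hky.symm ((hp (i + 1) (by omega) i (by omega)).2 (.inr rfl)) hxi.symm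
          hcx hcy (hi _ (by omega) le_rfl) (fun h => hpy i hik h.symm) (hcp _ le_rfl)
          (hcp _ (by omega))
      · refine hG.hole (fun j => p (i + j)) (k + 1 - i) x (by omega) (fun a ha b hb => ?_)
          (fun a ha => ?_)
        · rw [hp _ (by omega) _ (by omega)]
          omega
        · constructor
          · intro h
            by_contra hne
            exact hi (i + a) (by omega) (by omega) h
          · rintro (rfl | rfl)
            · exact hxi
            · rwa [show i + (k + 1 - i) = k + 1 by omega, hn]
    · have hxa : ∀ a ≤ k + 1 - i, (G.Adj x (p (i + a)) ↔ a = 0) := fun a ha => by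
        constructor
        · intro h
          by_contra hne
          rcases (show i + a = k + 1 ∨ i + a ≤ k by omega) with h' | h'
          · rw [h', hn] at h
            exact hxy h
          · exact hi (i + a) (by omega) h' h
        · rintro rfl
          exact hxi
      refine hG.hole (fun j => if j = 0 then x else p (i + (j - 1))) (k + 2 - i) c (by omega)
        (fun a ha b hb => ?_) (fun a ha => ?_)
      · by_cases ha0 : a = 0 <;> by_cases hb0 : b = 0
        · simp [ha0, hb0]
        · rw [if_pos ha0, if_neg hb0, hxa _ (by omega)]
          omega
        · rw [if_neg ha0, if_pos hb0, G.adj_comm, hxa _ (by omega)]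
          omega
        · rw [if_neg ha0, if_neg hb0, hp _ (by omega) _ (by omega)]
          omega
      · by_cases ha0 : a = 0
        · simp [ha0, hcx]
        · rw [if_neg ha0]
          rcases (show a = k + 2 - i ∨ i + (a - 1) ≤ k by omega) with rfl | h'
          · rw [show i + (k + 2 - i - 1) = k + 1 by omega, hn]
            simp [hcy]
          · simp only [hcp _ h', false_iff]
            omega
  -- Here `x` is adjacent to the last vertex before `y`. The previous path neighbour `p j` of `x`
  -- leaves a hole, domino, house or gem, according to its distance and to whether `x` and `y` are
  -- adjacent.
  · clear hi hik
    obtain ⟨k, rfl⟩ : ∃ m, i = m + 1 := ⟨i - 1, by omega⟩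
    obtain ⟨j, hjk, hxj, hj⟩ := hlast k
    have hkk : G.Adj (p k) (p (k + 1)) := (hp k (by omega) (k + 1) (by omega)).2 (.inl rfl)
    rcases hjk.lt_or_eq with hjk | rfl
    · rcases (show j + 1 = k ∨ j + 1 < k by omega) with rfl | hjk'
      · have hjj : G.Adj (p j) (p (j + 1)) := (hp j (by omega) (j + 1) (by omega)).2 (.inl rfl)
        have hj2 : ¬ G.Adj (p j) (p (j + 1 + 1)) := by
          rw [hp j (by omega) _ (by omega)]
          omega
        by_cases hxy : G.Adj x y
        · exact hG.house hxi hkk.symm hjj.symm hxj.symm hxy.symm hky.symm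
            (hj _ (by omega) le_rfl) (fun h => hj2 h.symm) (fun h => hpy _ (by omega) h.symm)
            (fun h => hpy _ (by omega) h.symm)
        · exact hG.domino hxj hjj hkk hky hcy.symm hcx hxi
            (hj _ (by omega) le_rfl) hxy hj2 (fun h => hcp _ (by omega) h.symm)
            (hpy _ (by omega)) (fun h => hcp _ (by omega) h.symm)
            (fun h => hcp _ (by omega) h.symm) (hpy _ (by omega))
      · refine hG.hole (fun a => p (j + a)) (k + 1 - j) x (by omega) (fun a ha b hb => ?_)
          (fun a ha => ?_)
        · rw [hp _ (by omega) _ (by omega)]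
          omega
        · constructor
          · intro h
            by_contra hne
            exact hj (j + a) (by omega) (by omega) h
          · rintro (rfl | rfl)
            · exact hxj
            · rwa [show j + (k + 1 - j) = k + 1 by omega]
    · by_cases hxy : G.Adj x y
      · exact hG.gem hcy hky.symm hkk.symm hcx.symm hxy hxi hxj (hcp _ (by omega))
          (hcp _ (by omega)) (fun h => hpy _ (by omega) h.symm)
      · exact hG.house hxi hky hcy.symm hcx hxj.symm hkk hxy
          (fun h => hcp _ (by omega) h.symm) (hpy _ (by omega))
          (fun h => hcp _ (by omega) h.symm)

/-- The attachments in `N(c)` of two components of non-neighbours of `c` do not cross. -/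
theorem not_crossing (hG : G.HHDGFree) {c x y w r s : V} (hcx : G.Adj c x) (hcy : G.Adj c y)
    (hcw : G.Adj c w) (hrx : G.Adj r x) (hry : G.Adj r y) (hrw : ¬ G.Adj r w) (hsx : G.Adj s x)
    (hsw : G.Adj s w) (hsy : ¬ G.Adj s y) (hrs : ¬ G.Adj r s) (hcr : ¬ G.Adj c r)
    (hcs : ¬ G.Adj c s) : False := by
  have hwr := mt Adj.symm hrw
  have hys := mt Adj.symm hsy
  have hsr := mt Adj.symm hrs
  have hrc := mt Adj.symm hcr
  have hsc := mt Adj.symm hcs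
  -- Of the eight patterns on `x`, `y`, `w` only the edgeless one needs the domino; every other
  -- gives a gem or a house.
  by_cases hyw : G.Adj y w <;> by_cases hxy : G.Adj x y <;> by_cases hxw : G.Adj x w
  · exact hG.gem hry hyw hsw.symm hrx.symm hxy hxw hsx.symm hrw hrs hys
  · exact hG.house hxy hyw hsw.symm hsx hrx hry hxw hys hrw hrs
  · exact hG.house hxw hyw.symm hry.symm hrx hsx hsw hxy hwr hsy hsr
  · exact hG.house hcy.symm hcx hrx.symm hry hyw.symm hcw.symm (fun h => hxy h.symm) hcr
      (fun h => hxw h.symm) hwr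
  · exact hG.gem hry hcy.symm hcw hrx.symm hxy hcx.symm hxw hrc hrw hyw
  · exact hG.house hcx hsx.symm hsw hcw.symm hcy.symm hxy.symm hcs hxw hys hyw
  · exact hG.house hcx hrx.symm hry hcy.symm hcw.symm hxw.symm hcr hxy hwr (fun h => hyw h.symm)
  · exact hG.domino hcy hry.symm hrx hsx.symm hsw hcw.symm hcx hcr hcs (fun h => hxy h.symm)
      hyw hrs hrw hxw hys

/-- A neighbour of `c` outside the attachment of a component cannot distinguish two vertices of that
attachment: the failure is a gem with hub `x`, or a house on the 4-cycle `c x r y` with roof `z`. -/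
theorem adj_of_adj (hG : G.HHDGFree) {c x y z r : V} (hcx : G.Adj c x) (hcy : G.Adj c y)
    (hcz : G.Adj c z) (hrx : G.Adj r x) (hry : G.Adj r y) (hrz : ¬ G.Adj r z)
    (hcr : ¬ G.Adj c r) (hzx : G.Adj z x) : G.Adj z y := by
  by_contra hzy
  by_cases hxy : G.Adj x y
  · exact hG.gem hcz.symm hcy hry.symm hzx.symm hcx.symm hxy hrx.symm hzy (fun h => hrz h.symm) hcr
  · exact hG.house hcx hrx.symm hry hcy.symm hcz.symm hzx hcr hxy (fun h => hrz h.symm) hzy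

end HHDGFree

/-! ### Twins in graphs without an induced four-vertex path -/

/-- No four vertices of `A` induce a path. -/
def PathFourFreeOn (G : SimpleGraph V) (A : Finset V) : Prop :=
  ∀ a ∈ A, ∀ b ∈ A, ∀ c ∈ A, ∀ d ∈ A, G.Adj a b → G.Adj b c → G.Adj c d → ¬ G.Adj a c →
    ¬ G.Adj b d → ¬ G.Adj a d → False

/-- Two vertices of `A` that no third vertex of `A` distinguishes. -/
def HasTwinsOn (G : SimpleGraph V) (A : Finset V) : Prop :=
  ∃ x ∈ A, ∃ y ∈ A, x ≠ y ∧ ∀ z ∈ A, z ≠ x → z ≠ y → (G.Adj x z ↔ G.Adj y z)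

theorem PathFourFreeOn.mono {A B : Finset V} (h : G.PathFourFreeOn A) (hBA : B ⊆ A) :
    G.PathFourFreeOn B := fun a ha b hb c hc d hd =>
  h a (hBA ha) b (hBA hb) c (hBA hc) d (hBA hd)

/-- The path on four vertices is self-complementary: `a b c d` in the complement is `b d a c` in
`G`. -/
theorem PathFourFreeOn.compl {A : Finset V} (h : G.PathFourFreeOn A) : Gᶜ.PathFourFreeOn A := by
  intro a ha b hb c hc d hd hab hbc hcd hac hbd had
  simp only [compl_adj, not_and, not_not] at *
  have hac' : a ≠ c := by rintro rfl; exact hcd.2 (had hcd.1)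
  have hbd' : b ≠ d := by rintro rfl; exact hab.2 (had hab.1)
  have had' : a ≠ d := by rintro rfl; exact hab.2 (hbd hab.1.symm).symm
  exact h b hb d hd a ha c hc (hbd hbd') (had had').symm (hac hac') (fun h => hab.2 h.symm)
    (fun h => hcd.2 h.symm) hbc.2

theorem HasTwinsOn.compl {A : Finset V} (h : G.HasTwinsOn A) : Gᶜ.HasTwinsOn A := by
  obtain ⟨x, hx, y, hy, hxy, h⟩ := h
  refine ⟨x, hx, y, hy, hxy, fun z hz hzx hzy => ?_⟩
  simp [compl_adj, hzx.symm, hzy.symm, h z hz hzx hzy]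

/-- The component `R` of `r` among the non-neighbours of `c` is a module with at least two vertices,
and it misses `c`. Twins inside a module are twins in all of `A`. -/
theorem PathFourFreeOn.hasTwinsOn_of_adj {A : Finset V} (hA : G.PathFourFreeOn A)
    (ih : ∀ B ⊂ A, 2 ≤ B.card → G.HasTwinsOn B) {c r s : V} (hc : c ∈ A) (hr : r ∈ A) (hs : s ∈ A)
    (hrc : r ≠ c) (hsc : s ≠ c) (hcr : ¬ G.Adj c r) (hcs : ¬ G.Adj c s) (hrs : G.Adj r s) :
    G.HasTwinsOn A := by
  classical
  set R := A.filter fun z =>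
    Relation.ReflTransGen (fun a b => G.Adj a b ∧ b ∈ A ∧ b ≠ c ∧ ¬ G.Adj c b) r z with hR
  have hRc : ∀ z ∈ R, z ≠ c ∧ ¬ G.Adj c z := by
    intro z hz
    rcases (Finset.mem_filter.1 hz).2.cases_tail with rfl | ⟨b, -, h⟩
    · exact ⟨hrc, hcr⟩
    · exact h.2.2
  have hRA : R ⊂ A := Finset.ssubset_iff_subset_ne.2
    ⟨Finset.filter_subset _ _, fun h => (hRc c (h ▸ hc)).1 rfl⟩
  have hrR : r ∈ R := Finset.mem_filter.2 ⟨hr, .refl⟩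
  have hsR : s ∈ R := Finset.mem_filter.2 ⟨hs, .single ⟨hrs, hs, hsc, hcs⟩⟩
  have step : ∀ a ∈ R, ∀ b ∈ A, b ≠ c → ¬ G.Adj c b → G.Adj a b → b ∈ R :=
    fun a ha b hb hbc hcb hab =>
    Finset.mem_filter.2 ⟨hb, (Finset.mem_filter.1 ha).2.tail ⟨hab, hb, hbc, hcb⟩⟩
  -- A neighbour `z` of `c` seeing only one end of an edge in `R` would give an induced path
  -- starting with `c`, `z`. A non-neighbour of `c` outside `R` sees nothing in `R`.
  have hmod : ∀ z ∈ A, z ∉ R → ∀ a ∈ R, (G.Adj a z ↔ G.Adj r z) := by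
    intro z hz hzR a ha
    by_cases hcz : G.Adj c z
    · have hra := (Finset.mem_filter.1 ha).2
      clear ha
      induction hra with
      | refl => rfl
      | @tail a b hra hab ih =>
        have haR : a ∈ R := by
          rcases hra.cases_tail with rfl | ⟨d, -, h⟩
          · exact hrR
          · exact Finset.mem_filter.2 ⟨h.2.1, hra⟩
        have hbR := step a haR b hab.2.1 hab.2.2.1 hab.2.2.2 hab.1
        refine Iff.trans ?_ ih
        have haA := hRA.1 haR
        constructor <;> intro h <;> by_contra h'
        · exact hA c hc z hz b hab.2.1 a haA hcz h.symm hab.1.symm hab.2.2.2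
            (fun h => h' h.symm) (hRc a haR).2
        · exact hA c hc z hz a haA b hab.2.1 hcz h.symm hab.1 (hRc a haR).2
            (fun h => h' h.symm) hab.2.2.2
    · have hno : ∀ a ∈ R, ¬ G.Adj a z := fun a ha h => by
        by_cases hzc : z = c
        · exact (hRc a ha).2 (hzc ▸ h.symm)
        · exact hzR (step a ha z hz hzc hcz h)
      simp [hno a ha, hno r hrR]
  obtain ⟨x, hx, y, hy, hxy, h⟩ := ih R hRA (Finset.one_lt_card.2 ⟨r, hrR, s, hsR, hrs.ne⟩)
  refine ⟨x, hRA.1 hx, y, hRA.1 hy, hxy, fun z hz hzx hzy => ?_⟩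
  by_cases hzR : z ∈ R
  · exact h z hzR hzx hzy
  · rw [hmod z hz hzR x hx, hmod z hz hzR y hy]

/-- Let `c` have maximal degree. The previous lemma, applied to `G` or to its complement, leaves the
case where the neighbours of `c` form a clique and the non-neighbours are independent; there `c`
itself has a twin. -/
theorem PathFourFreeOn.hasTwinsOn {A : Finset V} (hA : G.PathFourFreeOn A) (hcard : 2 ≤ A.card) :
    G.HasTwinsOn A := by
  classical
  induction A using Finset.strongInduction with
  | H A ih =>
    have ih' : ∀ B ⊂ A, 2 ≤ B.card → G.HasTwinsOn B := fun B hB => ih B hB (hA.mono hB.1)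
    obtain ⟨c, hc, hmax⟩ := A.exists_max_image (fun v => (A.filter (G.Adj v)).card)
      (Finset.card_pos.1 (by omega))
    by_cases h1 : ∃ r ∈ A, ∃ s ∈ A, r ≠ c ∧ s ≠ c ∧ ¬ G.Adj c r ∧ ¬ G.Adj c s ∧ G.Adj r s
    · obtain ⟨r, hr, s, hs, hrc, hsc, hcr, hcs, hrs⟩ := h1
      exact hA.hasTwinsOn_of_adj ih' hc hr hs hrc hsc hcr hcs hrs
    by_cases h2 : ∃ r ∈ A, ∃ s ∈ A, r ≠ s ∧ G.Adj c r ∧ G.Adj c s ∧ ¬ G.Adj r s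
    · obtain ⟨r, hr, s, hs, hrs, hcr, hcs, hrs'⟩ := h2
      have := hA.compl.hasTwinsOn_of_adj (fun B hB h => (ih' B hB h).compl) hc hr hs hcr.ne' hcs.ne'
        (by simp [hcr]) (by simp [hcs]) (by simp [hrs, hrs'])
      simpa using this.compl
    push Not at h1 h2
    by_cases h3 : ∃ x ∈ A, G.Adj c x
    · obtain ⟨x, hx, hcx⟩ := h3
      have hnot : ∀ z ∈ A, z ≠ c → ¬ G.Adj c z → ¬ G.Adj x z := by
        intro z hz hzc hcz hxz
        have hle := hmax x hx
        -- If `x` had a neighbour `z` not adjacent to `c`, its degree would exceed that of `c` by at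
        -- least one.
        have hsub : insert c (insert z ((A.filter (G.Adj c)).erase x)) ⊆ A.filter (G.Adj x) := by
          intro v hv
          simp only [Finset.mem_insert, Finset.mem_erase, Finset.mem_filter] at hv ⊢
          rcases hv with rfl | rfl | ⟨hvx, hv, hcv⟩
          · exact ⟨hc, hcx.symm⟩
          · exact ⟨hz, hxz⟩
          · exact ⟨hv, h2 x hx v hv (Ne.symm hvx) hcx hcv⟩
        have := Finset.card_le_card hsub
        rw [Finset.card_insert_of_notMem (by simp [hzc.symm]),
          Finset.card_insert_of_notMem (by simp [hcz]), Finset.card_erase_of_mem (by simp [hx, hcx])]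
          at this
        have hpos : 0 < (A.filter (G.Adj c)).card := Finset.card_pos.2 ⟨x, by simp [hx, hcx]⟩
        omega
      refine ⟨x, hx, c, hc, hcx.ne', fun z hz hzx hzc => ⟨fun h => ?_, fun h => ?_⟩⟩
      · by_contra hcz
        exact hnot z hz hzc hcz h
      · exact h2 x hx z hz hzx.symm hcx h
    · push Not at h3
      obtain ⟨x, hx, hxc⟩ := Finset.exists_mem_ne (show 1 < A.card by omega) c
      refine ⟨x, hx, c, hc, hxc, fun z hz hzx hzc => ?_⟩
      simp [h3 z hz, h1 x hx z hz hxc hzc (h3 x hx) (h3 z hz)]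

/-! ### Pruning in graphs without the forbidden subgraphs -/

/-- Avoiding the prescribed vertex `c` is what makes the induction work: a component attached at one
vertex `d` is treated by itself with `d` prescribed, and what is found then lies in the component,
away from all other vertices. -/
theorem HHDGFree.exists_pendant_or_twins (hG : G.HHDGFree) (A : Finset V) (hA : 2 ≤ A.card)
    {c : V} (hc : c ∈ A) :
    (∃ v ∈ A, v ≠ c ∧ ∃ w, ∀ z ∈ A, G.Adj v z → z = w) ∨
      ∃ x ∈ A, ∃ y ∈ A, x ≠ c ∧ y ≠ c ∧ x ≠ y ∧
        ∀ z ∈ A, z ≠ x → z ≠ y → (G.Adj x z ↔ G.Adj y z) := by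
  classical
  induction A using Finset.strongInduction generalizing c with
  | H A ih =>
    have hcog : ∀ S : Finset V, (∀ x ∈ S, G.Adj c x) → 2 ≤ S.card → G.HasTwinsOn S :=
      fun S hS => PathFourFreeOn.hasTwinsOn fun x hx y hy z hz w hw hxy hyz hzw hxz hyw hxw =>
        hG.gem hxy hyz hzw (hS x hx) (hS y hy) (hS z hz) (hS w hw) hxz hxw hyw
    set B := A.filter fun z => z ≠ c ∧ ¬ G.Adj c z with hB
    have memB : ∀ z, z ∈ B ↔ z ∈ A ∧ z ≠ c ∧ ¬ G.Adj c z := fun z => by simp [hB]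
    rcases B.eq_empty_or_nonempty with hBe | hBne
    · have hcz : ∀ z ∈ A, z ≠ c → G.Adj c z := fun z hz hzc => by
        by_contra h
        exact absurd ((memB z).2 ⟨hz, hzc, h⟩) (by simp [hBe])
      obtain ⟨v, hv, hvc⟩ := Finset.exists_mem_ne (show 1 < A.card by omega) c
      by_cases h2 : 2 ≤ (A.erase c).card
      · right
        obtain ⟨x, hx, y, hy, hxy, h⟩ := hcog (A.erase c)
          (fun x hx => hcz x (Finset.mem_of_mem_erase hx) (Finset.ne_of_mem_erase hx)) h2
        simp only [Finset.mem_erase] at hx hy h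
        refine ⟨x, hx.2, y, hy.2, hx.1, hy.1, hxy, fun z hz hzx hzy => ?_⟩
        by_cases hzc : z = c
        · subst hzc
          simp [(hcz x hx.2 hx.1).symm, (hcz y hy.2 hy.1).symm]
        · exact h z ⟨hzc, hz⟩ hzx hzy
      · left
        refine ⟨v, hv, hvc, c, fun z hz hvz => ?_⟩
        by_contra hzc
        exact h2 (Finset.one_lt_card.2 ⟨v, Finset.mem_erase.2 ⟨hvc, hv⟩, z,
          Finset.mem_erase.2 ⟨hzc, hz⟩, hvz.ne⟩)
    -- `R r` is the component of `r` among the non-neighbours of `c`, and `S r` is its attachment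
    -- among the neighbours of `c`.
    · let reach : V → V → Prop := Relation.ReflTransGen fun a b => G.Adj a b ∧ b ∈ B
      let R : V → Finset V := fun r => B.filter (reach r)
      let S : V → Finset V := fun r => A.filter fun x => G.Adj c x ∧ ∃ z ∈ R r, G.Adj z x
      have memR : ∀ r z, z ∈ R r ↔ z ∈ B ∧ reach r z := fun r z => by simp [R]
      have memS : ∀ r x, x ∈ S r ↔ x ∈ A ∧ G.Adj c x ∧ ∃ z ∈ R r, G.Adj z x := fun r x => by
        simp [S]
      have hsymm : ∀ a ∈ B, ∀ b, reach a b → reach b a := by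
        intro a ha b hab
        induction hab with
        | refl => exact .refl
        | @tail b d hab hbd ih =>
          have hb : b ∈ B := by
            rcases hab.cases_tail with rfl | ⟨_, -, h⟩
            · exact ha
            · exact h.2
          exact .head ⟨hbd.1.symm, hb⟩ ih
      have hRS : ∀ r ∈ B, ∀ v ∈ R r, ∀ x ∈ S r, ∀ y ∈ S r, G.Adj v x → G.Adj v y := by
        intro r hr v hv x hx y hy hvx
        obtain ⟨-, hcy, s, hs, hsy⟩ := (memS r y).1 hy
        rw [memR] at hv hs
        exact hG.adj_of_reachable (B := (· ∈ B)) (fun z hz => ((memB z).1 hz).2.2)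
          ((memS r x).1 hx).2.1 hcy hv.1 ((hsymm r hr v hv.2).trans hs.2) hsy hvx
      have hrR : ∀ r ∈ B, r ∈ R r := fun r hr => (memR r r).2 ⟨hr, .refl⟩
      have hnbr : ∀ r, ∀ v ∈ R r, ∀ z ∈ A, G.Adj v z → z ∈ R r ∨ z ∈ S r := by
        intro r v hv z hz hvz
        obtain ⟨hvB, hrv⟩ := (memR r v).1 hv
        by_cases hcz : G.Adj c z
        · exact .inr ((memS r z).2 ⟨hz, hcz, v, hv, hvz⟩)
        · have hzB : z ∈ B := (memB z).2
            ⟨hz, fun h => ((memB v).1 hvB).2.2 (h ▸ hvz.symm), hcz⟩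
          exact .inl ((memR r z).2 ⟨hzB, hrv.tail ⟨hvz, hzB⟩⟩)
      have hRA : ∀ r, ∀ v ∈ R r, v ∈ A ∧ v ≠ c ∧ ¬ G.Adj c v := fun r v hv =>
        (memB v).1 ((memR r v).1 hv).1
      obtain ⟨r, hr, hmin⟩ := B.exists_min_image (fun r => (S r).card) hBne
      rcases Nat.lt_or_ge (S r).card 2 with hS | hS
      · have hsub : R r ∪ S r ⊂ A := by
          refine Finset.ssubset_iff_subset_ne.2 ⟨fun v hv => ?_, fun h => ?_⟩
          · rcases Finset.mem_union.1 hv with hv | hv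
            · exact (hRA r v hv).1
            · exact ((memS r v).1 hv).1
          · rcases Finset.mem_union.1 (h ▸ hc) with hv | hv
            · exact (hRA r c hv).2.1 rfl
            · exact G.irrefl ((memS r c).1 hv).2.1
        -- With an empty attachment any vertex can be prescribed; `r` is taken.
        obtain ⟨d, hd, hSd⟩ : ∃ d ∈ R r ∪ S r, ∀ v ∈ S r, v = d := by
          rcases (S r).eq_empty_or_nonempty with h | ⟨d, hd⟩
          · exact ⟨r, Finset.mem_union_left _ (hrR r hr), by simp [h]⟩
          · exact ⟨d, Finset.mem_union_right _ hd, fun v hv =>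
              Finset.card_le_one.1 (by omega) v hv d hd⟩
        have hR : ∀ v ∈ R r ∪ S r, v ≠ d → v ∈ R r := fun v hv hvd =>
          (Finset.mem_union.1 hv).resolve_right fun h => hvd (hSd v h)
        have hnbr' : ∀ v ∈ R r, ∀ z ∈ A, G.Adj v z → z ∈ R r ∪ S r := fun v hv z hz hvz =>
          Finset.mem_union.2 (hnbr r v hv z hz hvz)
        by_cases h2 : 2 ≤ (R r ∪ S r).card
        · rcases ih _ hsub h2 hd with ⟨v, hv, hvd, w, hw⟩ | ⟨x, hx, y, hy, hxd, hyd, hxy, h⟩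
          · have hv := hR v hv hvd
            exact .inl ⟨v, (hRA r v hv).1, (hRA r v hv).2.1, w, fun z hz hvz =>
              hw z (hnbr' v hv z hz hvz) hvz⟩
          · have hx := hR x hx hxd
            have hy := hR y hy hyd
            refine .inr ⟨x, (hRA r x hx).1, y, (hRA r y hy).1, (hRA r x hx).2.1, (hRA r y hy).2.1,
              hxy, fun z hz hzx hzy => ?_⟩
            by_cases hzR : z ∈ R r ∪ S r
            · exact h z hzR hzx hzy
            · exact ⟨fun h => absurd (hnbr' x hx z hz h) hzR,
                fun h => absurd (hnbr' y hy z hz h) hzR⟩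
        · refine .inl ⟨r, (hRA r r (hrR r hr)).1, (hRA r r (hrR r hr)).2.1, r, fun z hz hrz => ?_⟩
          exact absurd (Finset.one_lt_card.2 ⟨r, Finset.mem_union_left _ (hrR r hr), z,
            hnbr' r (hrR r hr) z hz hrz, hrz.ne⟩) h2
      · right
        have hcS : ∀ x ∈ S r, G.Adj c x := fun x hx => ((memS r x).1 hx).2.1
        -- The minimal attachment is a module of `A`, so twins within it are twins in `A`.
        have key : ∀ x ∈ S r, ∀ y ∈ S r, ∀ z ∈ A, z ∉ S r → G.Adj x z → G.Adj y z := by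
          intro x hx y hy z hz hzS hxz
          obtain ⟨-, hcx, s, hs, hsx⟩ := (memS r x).1 hx
          have hsy := hRS r hr s hs x hx y hy hsx
          by_cases hzc : z = c
          · exact hzc ▸ (hcS y hy).symm
          by_cases hcz : G.Adj c z
          · exact (hG.adj_of_adj hcx (hcS y hy) hcz hsx hsy
              (fun h => hzS ((memS r z).2 ⟨hz, hcz, s, hs, h⟩)) (hRA r s hs).2.2 hxz.symm).symm
          · by_contra hyz
            have hzB : z ∈ B := (memB z).2 ⟨hz, hzc, hcz⟩
            have hxSz : x ∈ S z := (memS z x).2 ⟨((memS r x).1 hx).1, hcx, z, hrR z hzB, hxz.symm⟩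
            have hySz : y ∉ S z := fun h =>
              hyz (hRS z hzB z (hrR z hzB) x hxSz y h hxz.symm).symm
            -- `S z` misses `y`, so by minimality of `S r` it cannot lie inside `S r`. The two
            -- attachments therefore cross.
            obtain ⟨w, hw, hwS⟩ : ∃ w ∈ S z, w ∉ S r := by
              by_contra hno
              push Not at hno
              exact hySz (Finset.eq_of_subset_of_card_le hno (hmin z hzB) ▸ hy)
            obtain ⟨hwA, hcw, -⟩ := (memS z w).1 hw
            refine hG.not_crossing hcx (hcS y hy) hcw hsx hsy
              (fun h => hwS ((memS r w).2 ⟨hwA, hcw, s, hs, h⟩)) hxz.symm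
              (hRS z hzB z (hrR z hzB) x hxSz w hw hxz.symm) (fun h => hyz h.symm) (fun h => ?_)
              (hRA r s hs).2.2 hcz
            have hzR := (hnbr r s hs z hz h).resolve_right hzS
            exact hyz (hRS r hr z hzR x hx y hy hxz.symm).symm
        obtain ⟨x, hx, y, hy, hxy, h⟩ := hcog (S r) hcS hS
        refine ⟨x, ((memS r x).1 hx).1, y, ((memS r y).1 hy).1, (hcS x hx).ne', (hcS y hy).ne', hxy,
          fun z hz hzx hzy => ?_⟩
        by_cases hzS : z ∈ S r
        · exact h z hzS hzx hzy
        · exact ⟨key x hx y hy z hz hzS, key y hy x hx z hz hzS⟩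

end SimpleGraph

/-! ### Attaching a vertex to a polytree -/

theorem Set.ncard_option {W : Type*} [Finite W] (s : Set (Option W)) [Decidable (none ∈ s)] :
    s.ncard = (some ⁻¹' s).ncard + if none ∈ s then 1 else 0 := by
  have him : (some '' (some ⁻¹' s)).ncard = (some ⁻¹' s).ncard :=
    Set.ncard_image_of_injective _ (Option.some_injective W)
  split_ifs with h
  · have : s = insert none (some '' (some ⁻¹' s)) := by
      ext (_ | a) <;> simp [h]
    conv_lhs => rw [this]
    rw [Set.ncard_insert_of_notMem (by simp), him]
  · have : s = some '' (some ⁻¹' s) := by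
      ext (_ | a) <;> simp [h]
    conv_lhs => rw [this]
    rw [him, add_zero]

namespace Digraph

variable {W : Type*} {N : Digraph W}

/-- Attach a new vertex `none` to the vertex `p`, as a child if `down = true` and as a parent
otherwise. -/
def attach (N : Digraph W) (p : W) (down : Bool) : Digraph (Option W) where
  Adj
    | some a, some b => N.Adj a b
    | some a, none => down = true ∧ a = p
    | none, some b => down = false ∧ b = p
    | none, none => False

section attach

variable {p : W} {d : Bool}

@[simp] theorem attach_adj_some_some {a b : W} :
    (N.attach p d).Adj (some a) (some b) ↔ N.Adj a b := .rfl

@[simp] theorem attach_adj_some_none {a : W} :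
    (N.attach p d).Adj (some a) none ↔ d = true ∧ a = p := .rfl

@[simp] theorem attach_adj_none_some {b : W} :
    (N.attach p d).Adj none (some b) ↔ d = false ∧ b = p := .rfl

@[simp] theorem not_attach_adj_none_none : ¬ (N.attach p d).Adj none none := id

open Classical in
theorem outDeg_attach_some [Finite W] (a : W) :
    (N.attach p d).outDeg (some a) = N.outDeg a + if d = true ∧ a = p then 1 else 0 := by
  refine (Set.ncard_option _).trans ?_
  simp [outDeg]

open Classical in
theorem inDeg_attach_some [Finite W] (a : W) :
    (N.attach p d).inDeg (some a) = N.inDeg a + if d = false ∧ a = p then 1 else 0 := by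
  refine (Set.ncard_option _).trans ?_
  simp [inDeg]

theorem outDeg_attach_none [Finite W] :
    (N.attach p d).outDeg none = if d = false then 1 else 0 := by
  classical
  refine (Set.ncard_option _).trans ?_
  cases d <;> simp

theorem inDeg_attach_none [Finite W] :
    (N.attach p d).inDeg none = if d = true then 1 else 0 := by
  classical
  refine (Set.ncard_option _).trans ?_
  cases d <;> simp

theorem isAncestor_attach_some_some {a b : W} :
    (N.attach p d).IsAncestor (some a) (some b) ↔ N.IsAncestor a b := by
  constructor
  · intro h
    -- The induction also covers the new vertex: it can be entered only if `d = true`, and then no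
    -- arc leaves it.
    have key : ∀ B, (N.attach p d).IsAncestor (some a) B →
        B.elim (d = true) fun b => N.IsAncestor a b := by
      intro B h
      induction h with
      | refl => exact .refl
      | @tail B C _ hBC ih =>
        rcases B with _ | x <;> rcases C with _ | y
        · exact hBC.elim
        · exact absurd hBC.1 (by simpa using ih)
        · exact hBC.1
        · exact Relation.ReflTransGen.tail ih hBC
    exact key _ h
  · intro h
    induction h with
    | refl => exact .refl
    | tail _ hbc ih => exact Relation.ReflTransGen.tail ih hbc

theorem isAncestor_attach_some_none {a : W} :
    (N.attach p d).IsAncestor (some a) none ↔ d = true ∧ N.IsAncestor a p := by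
  constructor
  · intro h
    rcases h.cases_tail with h | ⟨B, hB, hadj⟩
    · simp at h
    · cases B with
      | none => exact hadj.elim
      | some x =>
        obtain ⟨hd, rfl⟩ := hadj
        exact ⟨hd, isAncestor_attach_some_some.1 hB⟩
  · rintro ⟨hd, h⟩
    exact (isAncestor_attach_some_some.2 h).tail ⟨hd, rfl⟩

theorem isAncestor_attach_none_some {b : W} :
    (N.attach p d).IsAncestor none (some b) ↔ d = false ∧ N.IsAncestor p b := by
  constructor
  · intro h
    rcases h.cases_head with h | ⟨B, hadj, hB⟩
    · simp at h
    · cases B with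
      | none => exact hadj.elim
      | some x =>
        obtain ⟨hd, rfl⟩ := hadj
        exact ⟨hd, isAncestor_attach_some_some.1 hB⟩
  · rintro ⟨hd, h⟩
    exact .head (b := some p) ⟨hd, rfl⟩ (isAncestor_attach_some_some.2 h)

theorem IsAcyclic.attach (hN : N.IsAcyclic) : (N.attach p d).IsAcyclic := by
  rintro (_ | v) h
  · obtain ⟨(_ | x), h1, h2⟩ := Relation.TransGen.head'_iff.1 h
    · exact h1
    · have := (isAncestor_attach_some_none.1 h2).1
      simp [h1.1] at this
  · obtain ⟨(_ | x), h1, h2⟩ := Relation.TransGen.head'_iff.1 h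
    · have := (isAncestor_attach_none_some.1 h2).1
      simp [h1.1] at this
    · exact hN.not_adj_of_isAncestor (isAncestor_attach_some_some.1 h2) h1

theorem isTree_attach (hN : N.toSimpleGraphInclusive.IsTree) :
    (N.attach p d).toSimpleGraphInclusive.IsTree := by
  set H := N.toSimpleGraphInclusive with hH
  set K := (N.attach p d).toSimpleGraphInclusive with hK
  have hss : ∀ a b, K.Adj (some a) (some b) ↔ H.Adj a b := fun a b => by
    simp [hK, hH, toSimpleGraphInclusive]
  have hns : ∀ b, K.Adj none (some b) ↔ b = p := fun b => by
    cases d <;> simp [hK, toSimpleGraphInclusive]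
  constructor
  · have hp : ∀ a, K.Reachable (some p) a := by
      rintro (_ | a)
      · exact ((hns p).2 rfl).symm.reachable
      · exact (hN.connected p a).map ⟨some, fun {a b} h => (hss a b).2 h⟩
    exact ⟨fun a b => (hp a).symm.trans (hp b)⟩
  · rw [SimpleGraph.isAcyclic_iff_forall_adj_isBridge]
    have hnone : ∀ b, K.Adj none (some b) → K.IsBridge s(none, some b) := by
      intro b hab
      rw [SimpleGraph.isBridge_iff, SimpleGraph.reachable_iff_reflTransGen]
      intro h
      rcases h.cases_head with h | ⟨c, hc, -⟩
      · simp at h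
      · rw [SimpleGraph.deleteEdges_adj] at hc
        rcases c with _ | c
        · exact hc.1.ne rfl
        · have hcp := (hns c).1 hc.1
          subst hcp
          have hbp := (hns b).1 hab
          subst hbp
          exact hc.2 rfl
    rintro (_ | a) (_ | b) hab
    · exact absurd hab K.irrefl
    · exact hnone b hab
    · rw [Sym2.eq_swap]
      exact hnone a hab.symm
    · rw [SimpleGraph.isBridge_iff]
      intro h
      refine SimpleGraph.isBridge_iff.1
        (SimpleGraph.isAcyclic_iff_forall_adj_isBridge.1 hN.isAcyclic ((hss a b).1 hab)) ?_
      -- Collapsing the new vertex onto `p` turns a walk that avoids an old edge into a walk of the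
      -- old tree avoiding it.
      have key : ∀ x y : Option W, (K.deleteEdges {s(some a, some b)}).Reachable x y →
          (H.deleteEdges {s(a, b)}).Reachable (x.getD p) (y.getD p) := by
        intro x y h
        rw [SimpleGraph.reachable_iff_reflTransGen] at h
        induction h with
        | refl => exact .rfl
        | @tail y z _ hyz ih =>
          refine ih.trans ?_
          rw [SimpleGraph.deleteEdges_adj] at hyz
          obtain ⟨hyz, he⟩ := hyz
          rcases y with _ | y <;> rcases z with _ | z
          · exact .rfl
          · rw [hns] at hyz
            simp [hyz]
          · rw [K.adj_comm, hns] at hyz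
            simp [hyz]
          · rw [hss] at hyz
            refine SimpleGraph.Adj.reachable ((SimpleGraph.deleteEdges_adj).2 ⟨hyz, fun h => he ?_⟩)
            simpa using h
      exact key _ _ h

/-- The new vertex is never least: its only possible child is `p`, which is above every old vertex
that it is above. -/
theorem isLCA_attach_some_some {U : Option W} {x y : W} :
    (N.attach p d).IsLCA U (some x) (some y) ↔ ∃ u, U = some u ∧ N.IsLCA u x y := by
  rcases U with _ | u
  · simp only [reduceCtorEq, false_and, exists_false, iff_false]
    rintro ⟨⟨h1, h2⟩, h⟩
    rw [isAncestor_attach_none_some] at h1 h2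
    exact h (some p) ⟨h1.1, rfl⟩
      ⟨isAncestor_attach_some_some.2 h1.2, isAncestor_attach_some_some.2 h2.2⟩
  · simp only [Option.some.injEq, exists_eq_left', IsLCA, isAncestor_attach_some_some]
    refine and_congr_right fun _ => ⟨fun h c hc => ?_, ?_⟩
    · simpa only [isAncestor_attach_some_some] using h (some c) hc
    · rintro h (_ | c) hc
      · rintro ⟨h', -⟩
        simp [isAncestor_attach_none_some, hc.1] at h'
      · simpa only [isAncestor_attach_some_some] using h c hc

theorem isLCA_attach_some_none {U : Option W} {x : W} :
    (N.attach p true).IsLCA U (some x) none ↔ ∃ u, U = some u ∧ N.IsLCA u x p := by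
  rcases U with _ | u
  · simp [IsLCA, isAncestor_attach_none_some]
  · simp only [Option.some.injEq, exists_eq_left', IsLCA, isAncestor_attach_some_some,
      isAncestor_attach_some_none, true_and]
    refine and_congr_right fun _ => ⟨fun h c hc => ?_, ?_⟩
    · simpa only [isAncestor_attach_some_some, isAncestor_attach_some_none, true_and] using
        h (some c) hc
    · rintro h (_ | c) hc
      · simp [isAncestor_attach_none_some]
      · simpa only [isAncestor_attach_some_some, isAncestor_attach_some_none, true_and] using h c hc

theorem markedLCA_attach_some_some {T : Option W → Prop} {x y : W} :
    (N.attach p d).MarkedLCA T (some x) (some y) ↔ N.MarkedLCA (fun u => T (some u)) x y := by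
  simp only [MarkedLCA, isLCA_attach_some_some]
  aesop

theorem markedLCA_attach_some_none {T : Option W → Prop} {x : W} :
    (N.attach p true).MarkedLCA T (some x) none ↔ N.MarkedLCA (fun u => T (some u)) x p := by
  simp only [MarkedLCA, isLCA_attach_some_none]
  aesop

theorem markedLCA_attach_false_some_none {T : Option W → Prop} {x : W} :
    (N.attach p false).MarkedLCA T (some x) none ↔ T none ∧ N.IsAncestor p x := by
  constructor
  · rintro ⟨_ | u, ⟨⟨h1, h2⟩, -⟩, ht⟩
    · exact ⟨ht, (isAncestor_attach_none_some.1 h1).2⟩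
    · simp [isAncestor_attach_some_none] at h2
  · rintro ⟨ht, h⟩
    refine ⟨none, ⟨⟨isAncestor_attach_none_some.2 ⟨rfl, h⟩, .refl⟩, ?_⟩, ht⟩
    rintro (_ | c) hc
    · exact hc.elim
    · simp [isAncestor_attach_some_none]

end attach

theorem markedLCA_comm {t : W → Prop} {a b : W} : N.MarkedLCA t a b ↔ N.MarkedLCA t b a :=
  ⟨.symm, .symm⟩

theorem IsAcyclic.markedLCA_self (hN : N.IsAcyclic) {t : W → Prop} {a : W} :
    N.MarkedLCA t a a ↔ t a := by
  constructor
  · rintro ⟨u, ⟨⟨h, -⟩, hu⟩, ht⟩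
    rcases h.cases_head with rfl | ⟨c, huc, hca⟩
    · exact ht
    · exact absurd ⟨hca, hca⟩ (hu c huc)
  · exact fun ht => ⟨a, ⟨⟨.refl, .refl⟩, fun c hac hc => hN.not_adj_of_isAncestor hc.1 hac⟩, ht⟩

theorem outDeg_eq_zero_iff [Finite W] {v : W} : N.outDeg v = 0 ↔ ∀ c, ¬ N.Adj v c := by
  rw [outDeg, Set.ncard_eq_zero, Set.eq_empty_iff_forall_notMem]
  rfl

theorem IsAncestor.eq_of_outDeg_eq_zero [Finite W] {u v : W} (h : N.IsAncestor u v)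
    (hu : N.outDeg u = 0) : u = v := by
  rcases h.cases_head with h | ⟨c, hc, -⟩
  · exact h
  · exact absurd hc (outDeg_eq_zero_iff.1 hu c)

/-- The children leading to `a` and to `b` differ, as a shared one would be a lower common ancestor.
-/
theorem IsLCA.mem_branching [Finite W] {u a b : W} (h : N.IsLCA u a b) (hab : a ≠ b)
    (ha : N.outDeg a = 0) (hb : N.outDeg b = 0) : u ∈ N.branching := by
  obtain ⟨⟨h1, h2⟩, h3⟩ := h
  rcases h1.cases_head with rfl | ⟨c, huc, hca⟩
  · exact absurd (h2.eq_of_outDeg_eq_zero ha) hab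
  rcases h2.cases_head with rfl | ⟨e, hue, heb⟩
  · exact absurd (h1.eq_of_outDeg_eq_zero hb) hab.symm
  refine (Set.one_lt_ncard_iff).2 ⟨c, e, huc, hue, ?_⟩
  rintro rfl
  exact h3 c huc ⟨hca, heb⟩

theorem IsLCA.ne_of_outDeg_eq_zero [Finite W] {u a b w : W} (h : N.IsLCA u a b) (hab : a ≠ b)
    (hw : N.outDeg w = 0) : u ≠ w := by
  rintro rfl
  exact hab ((h.1.1.eq_of_outDeg_eq_zero hw).symm.trans (h.1.2.eq_of_outDeg_eq_zero hw))

/-! ### Reinserting twins and pendant vertices -/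

/-- The degree conditions at a vertex of a network. -/
def IsNetworkVertex (N : Digraph W) (v : W) : Prop :=
  (N.inDeg v = 0 → 2 ≤ N.outDeg v) ∧ (N.outDeg v = 0 → N.inDeg v = 1) ∧
    ¬ (N.inDeg v = 1 ∧ N.outDeg v = 1)

/-- The polytree `N`, with its vertices marked by `t` and its leaves named by `φ`, explains the
subgraph of `G` induced on `A`. -/
structure Explains {V : Type*} (N : Digraph W) (t : W → Prop) (φ : V → W) (G : SimpleGraph V)
    (A : Finset V) : Prop where
  acyclic : N.IsAcyclic
  isTree : N.toSimpleGraphInclusive.IsTree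
  injOn : ∀ x ∈ A, ∀ y ∈ A, φ x = φ y → x = y
  leaf_iff : ∀ w, N.outDeg w = 0 ↔ ∃ x ∈ A, φ x = w
  adj_iff : ∀ x ∈ A, ∀ y ∈ A, x ≠ y → (G.Adj x y ↔ N.MarkedLCA t (φ x) (φ y))

end Digraph

namespace SimpleGraph

variable {V : Type*} {G : SimpleGraph V}

/-- The subgraph of `G` induced on `A` is explained by a labelled arboreal network. -/
def ExplainableOn (G : SimpleGraph V) (A : Finset V) : Prop :=
  ∃ (W : Type) (_ : Finite W) (N : Digraph W) (t : W → Prop) (φ : V → W),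
    N.Explains t φ G A ∧ ∀ v, N.IsNetworkVertex v

end SimpleGraph

namespace Digraph.Explains

variable {V : Type*} {G : SimpleGraph V} {A : Finset V} {W : Type} {N : Digraph W}
  {t : W → Prop} {φ : V → W} [DecidableEq V]

/-- If `N'` arises from `N` by replacing the leaf of `x₀` with two leaves, of `x₀` and of `v`, then
it suffices to check adjacencies between `v` and the other leaves. -/
theorem insert {W' : Type} [Finite W'] {N' : Digraph W'} {T : W' → Prop} {ι : W → W'} {e₀ e₁ : W'}
    (h : N.Explains t φ G A) {x₀ v : V} (hx₀ : x₀ ∈ A) (hv : v ∉ A) (hacyc : N'.IsAcyclic)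
    (htree : N'.toSimpleGraphInclusive.IsTree) (hι : ι.Injective) (he : e₀ ≠ e₁)
    (hι₀ : ∀ u, ι u ≠ e₀) (hι₁ : ∀ u, ι u ≠ e₁)
    (hleaf : ∀ y, N'.outDeg y = 0 ↔ y = e₁ ∨ y = e₀ ∨ ∃ u, u ≠ φ x₀ ∧ N.outDeg u = 0 ∧ ι u = y)
    (hmark : ∀ a b, a ≠ b → (N'.MarkedLCA T (ι a) (ι b) ↔ N.MarkedLCA t a b))
    (hmark₀ : ∀ a, a ≠ φ x₀ → (N'.MarkedLCA T (ι a) e₀ ↔ N.MarkedLCA t a (φ x₀)))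
    (hadj : ∀ x ∈ A, x ≠ x₀ → (G.Adj x v ↔ N'.MarkedLCA T (ι (φ x)) e₁))
    (hadj₀ : G.Adj x₀ v ↔ N'.MarkedLCA T e₀ e₁) (hdeg : ∀ u, N'.IsNetworkVertex u) :
    G.ExplainableOn (insert v A) := by
  have hφ : ∀ x ∈ A, x ≠ x₀ → φ x ≠ φ x₀ := fun x hx hne he => hne (h.injOn x hx x₀ hx₀ he)
  have hvx₀ : x₀ ≠ v := fun h => hv (h ▸ hx₀)
  obtain ⟨ψ, hψv, hψ0, hψx⟩ : ∃ ψ : V → W', ψ v = e₁ ∧ ψ x₀ = e₀ ∧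
      ∀ x ∈ A, x ≠ x₀ → ψ x = ι (φ x) := by
    refine ⟨fun x => if x = v then e₁ else if x = x₀ then e₀ else ι (φ x), by simp, by simp [hvx₀],
      fun x hx hne => ?_⟩
    have : x ≠ v := fun h => hv (h ▸ hx)
    simp [this, hne]
  have hne : ∀ x ∈ A, ψ x ≠ ψ v := by
    intro x hx
    by_cases hx0 : x = x₀
    · rw [hx0, hψ0, hψv]
      exact he
    · rw [hψx x hx hx0, hψv]
      exact hι₁ _
  have hinj : ∀ x ∈ A, ∀ y ∈ A, ψ x = ψ y → x = y := by
    intro x hx y hy hxy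
    by_cases hx0 : x = x₀ <;> by_cases hy0 : y = x₀
    · exact hx0.trans hy0.symm
    · rw [hx0, hψ0, hψx y hy hy0] at hxy
      exact absurd hxy.symm (hι₀ _)
    · rw [hy0, hψ0, hψx x hx hx0] at hxy
      exact absurd hxy (hι₀ _)
    · rw [hψx x hx hx0, hψx y hy hy0] at hxy
      exact h.injOn x hx y hy (hι hxy)
  have hA : ∀ x ∈ A, ∀ y ∈ A, x ≠ y → (G.Adj x y ↔ N'.MarkedLCA T (ψ x) (ψ y)) := by
    intro x hx y hy hxy
    rw [h.adj_iff x hx y hy hxy]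
    by_cases hx0 : x = x₀
    · have hy0 : y ≠ x₀ := fun h => hxy (hx0.trans h.symm)
      rw [hx0, hψ0, hψx y hy hy0, markedLCA_comm, N'.markedLCA_comm, hmark₀ _ (hφ y hy hy0)]
    · rw [hψx x hx hx0]
      by_cases hy0 : y = x₀
      · rw [hy0, hψ0, hmark₀ _ (hφ x hx hx0)]
      · rw [hψx y hy hy0, hmark _ _ fun he => hxy (h.injOn x hx y hy he)]
  have hvA : ∀ x ∈ A, (G.Adj x v ↔ N'.MarkedLCA T (ψ x) (ψ v)) := by
    intro x hx
    rw [hψv]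
    by_cases hx0 : x = x₀
    · rw [hx0, hψ0, hadj₀]
    · rw [hψx x hx hx0, hadj x hx hx0]
  refine ⟨W', inferInstance, N', T, ψ, ⟨hacyc, htree, ?_, fun y => ?_, ?_⟩, hdeg⟩
  · intro x hx y hy hxy
    rcases Finset.mem_insert.1 hx with rfl | hx' <;> rcases Finset.mem_insert.1 hy with rfl | hy'
    · rfl
    · exact absurd hxy.symm (hne y hy')
    · exact absurd hxy (hne x hx')
    · exact hinj x hx' y hy' hxy
  · rw [hleaf]
    constructor
    · rintro (rfl | rfl | ⟨u, hu, hu0, rfl⟩)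
      · exact ⟨v, Finset.mem_insert_self _ _, hψv⟩
      · exact ⟨x₀, Finset.mem_insert_of_mem hx₀, hψ0⟩
      · obtain ⟨x, hx, rfl⟩ := (h.leaf_iff u).1 hu0
        exact ⟨x, Finset.mem_insert_of_mem hx, hψx x hx fun h => hu (h ▸ rfl)⟩
    · rintro ⟨x, hx, rfl⟩
      rcases Finset.mem_insert.1 hx with rfl | hx
      · exact .inl hψv
      · by_cases hx0 : x = x₀
        · exact .inr (.inl (hx0 ▸ hψ0))
        · exact .inr (.inr ⟨φ x, hφ x hx hx0, (h.leaf_iff _).2 ⟨x, hx, rfl⟩, (hψx x hx hx0).symm⟩)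
  · intro x hx y hy hxy
    rcases Finset.mem_insert.1 hx with rfl | hx' <;> rcases Finset.mem_insert.1 hy with rfl | hy'
    · exact absurd rfl hxy
    · rw [G.adj_comm, markedLCA_comm]
      exact hvA y hy'
    · exact hvA x hx'
    · exact hA x hx' y hy' hxy

/-- Two new leaves below the leaf of `x₀` explain the addition of a twin of `x₀`. -/
theorem insert_twin [Finite W] (h : N.Explains t φ G A) {x₀ v : V} (hx₀ : x₀ ∈ A) (hv : v ∉ A)
    (htwin : ∀ z ∈ A, z ≠ x₀ → (G.Adj z v ↔ G.Adj z x₀))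
    (hdeg : ∀ u ≠ φ x₀, N.IsNetworkVertex u) :
    G.ExplainableOn (Insert.insert v A) := by
  classical
  have hw : N.outDeg (φ x₀) = 0 := (h.leaf_iff _).2 ⟨x₀, hx₀, rfl⟩
  have hφ : ∀ x ∈ A, x ≠ x₀ → φ x ≠ φ x₀ := fun x hx hne he => hne (h.injOn x hx x₀ hx₀ he)
  -- The former leaf becomes the parent of both new leaves, and its mark records whether `x₀` and
  -- `v` are adjacent. Other pairs do not notice, since a leaf is never a least common ancestor of
  -- two distinct vertices.
  obtain ⟨T, hT⟩ : ∃ T : Option (Option W) → Prop,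
      ∀ u, T (some (some u)) = if u = φ x₀ then G.Adj x₀ v else t u :=
    ⟨fun u => u.elim False fun u => u.elim False fun u => if u = φ x₀ then G.Adj x₀ v else t u,
      fun u => rfl⟩
  have hmark : ∀ a b, a ≠ b →
      (N.MarkedLCA (fun u => T (some (some u))) a b ↔ N.MarkedLCA t a b) := by
    intro a b hab
    refine exists_congr fun u => and_congr_right fun hu => ?_
    simp [hT, hu.ne_of_outDeg_eq_zero hab hw]
  refine h.insert (N' := (N.attach (φ x₀) true).attach (some (φ x₀)) true) (T := T)
    (ι := fun u => some (some u)) (e₀ := some none) (e₁ := none) hx₀ hv h.acyclic.attach.attach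
    (isTree_attach (isTree_attach h.isTree)) (fun a b => by simp) (by simp) (by simp) (by simp)
    ?_ ?_ ?_ ?_ ?_ ?_
  · rintro (_ | _ | u)
    · simp [outDeg_attach_none]
    · simp [outDeg_attach_none, outDeg_attach_some]
    · simp [outDeg_attach_some, and_comm]
  · intro a b hab
    rw [markedLCA_attach_some_some, markedLCA_attach_some_some, hmark a b hab]
  · intro a ha
    rw [markedLCA_attach_some_some, markedLCA_attach_some_none, hmark _ _ ha]
  · intro x hx hx0
    rw [markedLCA_attach_some_none, markedLCA_attach_some_some, hmark _ _ (hφ x hx hx0),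
      htwin x hx hx0, h.adj_iff x hx x₀ hx₀ hx0]
  · rw [markedLCA_attach_some_none, markedLCA_comm, markedLCA_attach_some_none,
      h.acyclic.markedLCA_self, hT, if_pos rfl]
  · rintro (_ | _ | u)
    · simp [IsNetworkVertex, outDeg_attach_none, inDeg_attach_none]
    · simp [IsNetworkVertex, outDeg_attach_none, inDeg_attach_none, outDeg_attach_some,
        inDeg_attach_some]
    · by_cases hu : u = φ x₀
      · subst hu
        simp [IsNetworkVertex, outDeg_attach_some, inDeg_attach_some, hw]
      · simpa [IsNetworkVertex, outDeg_attach_some, inDeg_attach_some, hu] using hdeg u hu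

/-- A new root above the leaf of `x₀`, with a second child, explains the addition of a vertex
adjacent at most to `x₀`. -/
theorem insert_pendant [Finite W] (h : N.Explains t φ G A) {x₀ v : V} (hx₀ : x₀ ∈ A) (hv : v ∉ A)
    (hpend : ∀ z ∈ A, z ≠ x₀ → ¬ G.Adj z v) (hdeg : ∀ u, N.IsNetworkVertex u) :
    G.ExplainableOn (Insert.insert v A) := by
  classical
  have hw : N.outDeg (φ x₀) = 0 := (h.leaf_iff _).2 ⟨x₀, hx₀, rfl⟩
  have hin := (hdeg (φ x₀)).2.1 hw
  have hφ : ∀ x ∈ A, x ≠ x₀ → φ x ≠ φ x₀ := fun x hx hne he => hne (h.injOn x hx x₀ hx₀ he)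
  obtain ⟨T, hT, hT'⟩ : ∃ T : Option (Option (Option W)) → Prop,
      (∀ u, T (some (some (some u))) = t u) ∧ T (some none) = G.Adj x₀ v :=
    ⟨fun u => u.elim False fun u => u.elim (G.Adj x₀ v) fun u => u.elim False t,
      fun u => rfl, rfl⟩
  -- The attachments are, in order: a leaf for `x₀` below `φ x₀`, a second parent of `φ x₀`, and a
  -- leaf for `v` below that parent. So `φ x₀` ends with indegree two and outdegree one, which a
  -- network allows.
  refine h.insert
    (N' := ((N.attach (φ x₀) true).attach (some (φ x₀)) false).attach none true) (T := T)
    (ι := fun u => some (some (some u))) (e₀ := some (some none)) (e₁ := none) hx₀ hv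
    h.acyclic.attach.attach.attach (isTree_attach (isTree_attach (isTree_attach h.isTree)))
    (fun a b => by simp) (by simp) (by simp) (by simp) ?_ ?_ ?_ ?_ ?_ ?_
  · rintro (_ | _ | _ | u)
    · simp [outDeg_attach_none]
    · simp [outDeg_attach_none, outDeg_attach_some]
    · simp [outDeg_attach_none, outDeg_attach_some]
    · simp [outDeg_attach_some, and_comm]
  · intro a b hab
    simp only [markedLCA_attach_some_some, hT]
  · intro a ha
    simp only [markedLCA_attach_some_some, markedLCA_attach_some_none, hT]
  · intro x hx hx0
    rw [markedLCA_attach_some_none, markedLCA_attach_false_some_none, isAncestor_attach_some_some]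
    refine iff_of_false (hpend x hx hx0) fun hanc => ?_
    exact hφ x hx hx0 (hanc.2.eq_of_outDeg_eq_zero hw).symm
  · rw [markedLCA_attach_some_none, markedLCA_attach_false_some_none, isAncestor_attach_some_none,
      hT']
    simp [IsAncestor, Relation.ReflTransGen.refl]
  · rintro (_ | _ | _ | u)
    · simp [IsNetworkVertex, outDeg_attach_none, inDeg_attach_none]
    · simp [IsNetworkVertex, outDeg_attach_none, inDeg_attach_none, outDeg_attach_some,
        inDeg_attach_some]
    · simp [IsNetworkVertex, outDeg_attach_none, inDeg_attach_none, outDeg_attach_some,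
        inDeg_attach_some]
    · by_cases hu : u = φ x₀
      · subst hu
        simp [IsNetworkVertex, outDeg_attach_some, inDeg_attach_some, hw, hin]
      · simpa [IsNetworkVertex, outDeg_attach_some, inDeg_attach_some, hu] using hdeg u

end Digraph.Explains

/-! ### Construction of the network and conclusion -/

namespace SimpleGraph

variable {V : Type*} {G : SimpleGraph V}

open Digraph in
-- The base case splits a single vertex, which is not itself a network. This is why `insert_twin`
-- asks for the degree conditions only away from the leaf being split.
theorem explainableOn_pair [DecidableEq V] {x y : V} (hxy : x ≠ y) : G.ExplainableOn {y, x} := by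
  let N : Digraph Unit := ⟨fun _ _ => False⟩
  have hout : ∀ u, N.outDeg u = 0 := fun u => outDeg_eq_zero_iff.2 fun _ => id
  have h : N.Explains (fun _ => False) (fun _ : V => ()) G {x} := by
    refine ⟨fun v h => ?_, .of_subsingleton, by simp +contextual, fun w => ?_, by simp +contextual⟩
    · obtain ⟨_, h, -⟩ := Relation.TransGen.head'_iff.1 h
      exact h
    · simp [hout]
  exact h.insert_twin (x₀ := x) (by simp) (by simp [hxy.symm]) (by simp +contextual)
    fun u hu => absurd rfl hu

theorem HHDGFree.explainableOn (hG : G.HHDGFree) (A : Finset V) (hA : 2 ≤ A.card) :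
    G.ExplainableOn A := by
  classical
  induction A using Finset.strongInduction with
  | H A ih =>
    rcases hA.eq_or_lt with hA2 | hA3
    · obtain ⟨x, y, hxy, rfl⟩ := Finset.card_eq_two.1 hA2.symm
      exact explainableOn_pair hxy.symm
    have herase : ∀ v ∈ A, G.ExplainableOn (A.erase v) := fun v hv =>
      ih _ (Finset.erase_ssubset hv) (by rw [Finset.card_erase_of_mem hv]; omega)
    obtain ⟨c, hc⟩ : A.Nonempty := Finset.card_pos.1 (by omega)
    rcases hG.exists_pendant_or_twins A hA hc with ⟨v, hv, -, w, hw⟩ | ⟨x, hx, y, hy, -, -, hxy, h⟩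
    · obtain ⟨W, _, N, t, φ, hN, hdeg⟩ := herase v hv
      -- If `w` is not among the remaining vertices, `v` is isolated and may be hung next to any
      -- leaf.
      obtain ⟨x₀, hx₀, hx₀w⟩ : ∃ x₀ ∈ A.erase v, w ∈ A.erase v → x₀ = w := by
        by_cases hw : w ∈ A.erase v
        · exact ⟨w, hw, fun _ => rfl⟩
        · obtain ⟨u, hu, huv⟩ := Finset.exists_mem_ne (show 1 < A.card by omega) v
          exact ⟨u, Finset.mem_erase.2 ⟨huv, hu⟩, fun h => absurd h hw⟩
      rw [← Finset.insert_erase hv]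
      refine hN.insert_pendant hx₀ (Finset.notMem_erase _ _) (fun z hz hzx hzv => ?_) hdeg
      have := hw z (Finset.mem_of_mem_erase hz) hzv.symm
      exact hzx (this.trans (hx₀w (this ▸ hz)).symm)
    · obtain ⟨W, _, N, t, φ, hN, hdeg⟩ := herase y hy
      have hxA : x ∈ A.erase y := Finset.mem_erase.2 ⟨hxy, hx⟩
      rw [← Finset.insert_erase hy]
      refine hN.insert_twin hxA (Finset.notMem_erase _ _) (fun z hz hzx => ?_) fun u _ => hdeg u
      rw [G.adj_comm z y, G.adj_comm z x]
      exact (h z (Finset.mem_of_mem_erase hz) hzx (Finset.ne_of_mem_erase hz)).symm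

theorem ExplainableOn.arborealExplainable [Fintype V] (h : G.ExplainableOn Finset.univ) :
    G.ArborealExplainable := by
  classical
  obtain ⟨W, _, N, t, φ, hN, hdeg⟩ := h
  let e : V → N.leaves := fun x => ⟨φ x, (hN.leaf_iff _).2 ⟨x, Finset.mem_univ _, rfl⟩⟩
  have he : e.Bijective := by
    refine ⟨fun x y hxy => hN.injOn x (Finset.mem_univ _) y (Finset.mem_univ _)
      (congrArg Subtype.val hxy), fun ⟨w, hw⟩ => ?_⟩
    obtain ⟨x, -, hx⟩ := (hN.leaf_iff w).1 hw
    exact ⟨x, Subtype.ext hx⟩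
  refine ⟨W, inferInstance, N, fun u => if t u then 1 else 0, ⟨⟨hN.isTree.connected, hN.acyclic,
    fun v => (hdeg v).1, fun v => (hdeg v).2.1, fun v => (hdeg v).2.2⟩, hN.isTree⟩,
    ⟨⟨Equiv.ofBijective e he, fun {x y} => ?_⟩⟩⟩
  change (N.explainedGraph _).Adj (e x) (e y) ↔ G.Adj x y
  constructor
  · rintro ⟨hne, -, u, hu, ht⟩
    refine (hN.adj_iff x (Finset.mem_univ _) y (Finset.mem_univ _) fun h => hne (h ▸ rfl)).2
      ⟨u, hu, ?_⟩
    simpa using ht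
  · intro hxy
    obtain ⟨u, hu, ht⟩ := (hN.adj_iff x (Finset.mem_univ _) y (Finset.mem_univ _) hxy.ne).1 hxy
    have hne : e x ≠ e y := fun h => hxy.ne (he.1 h)
    exact ⟨hne, ⟨u, hu.1⟩, ⟨u, hu.mem_branching (fun h => hne (Subtype.ext h)) (e x).2 (e y).2⟩, hu,
      by simp [ht]⟩

theorem arborealExplainable_iff [Finite V] (hV : 2 ≤ Nat.card V) :
    G.ArborealExplainable ↔
      G.HoleFree ∧ ¬ houseGraph.IsIndContained G ∧ ¬ gemGraph.IsIndContained G ∧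
        ¬ dominoGraph.IsIndContained G := by
  refine ⟨ArborealExplainable.forbidden, fun ⟨h₁, h₂, h₃, h₄⟩ => ?_⟩
  have := Fintype.ofFinite V
  refine ExplainableOn.arborealExplainable ((h₁.hhdgFree h₂ h₃ h₄).explainableOn _ ?_)
  rwa [Finset.card_univ, ← Nat.card_eq_fintype_card]

end SimpleGraph

theorem mainTheorem3 {V : Type*} [Finite V] (G : SimpleGraph V) (hV : 2 ≤ Nat.card V) :
    (G.ArborealExplainable ↔
      G.HoleFree ∧ ¬ houseGraph.IsIndContained G ∧ ¬ gemGraph.IsIndContained G ∧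
        ¬ dominoGraph.IsIndContained G) ∧
    (G.ArborealExplainable →
      ∀ Y : Set V, 2 ≤ Y.ncard → (G.induce Y).ArborealExplainable) := by
  refine ⟨SimpleGraph.arborealExplainable_iff hV, fun hG Y hY => ?_⟩
  have hYG : (G.induce Y).IsIndContained G := ⟨SimpleGraph.Embedding.induce Y⟩
  obtain ⟨h₁, h₂, h₃, h₄⟩ := hG.forbidden
  exact (SimpleGraph.arborealExplainable_iff (by rwa [Nat.card_coe_set_eq])).2
    ⟨fun n hn h => h₁ n hn (h.trans hYG), fun h => h₂ (h.trans hYG), fun h => h₃ (h.trans hYG),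
      fun h => h₄ (h.trans hYG)⟩
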